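/- A \emph{partial field} is a set $P$ with elements $0,1$, a multiplication for which $P\setminus\{0\}$ is an abelian group with identity $1$ and $0p=p0=0$, and a partial addition such that: $p+0=p$; every $p$ has a unique $-p$ with $p+(-p)=0$; if $p+q$ is defined then so is $q+p$ and they are equal; for $p\neq0$, $p(q+r)$ is defined if and only if $pq+pr$ is, and then they are equal; and the following associative law holds. An \emph{association} of a finite nonempty multiset $S$ of elements of $P$ is a labelled binary tree whose leaves are labelled by the members of $S$ and in which the label of every other vertex is the (defined) sum of the labels of its two children; its value is the label of the root. The law says that if $S$ has an association with value $r$, and $S$ is split into two parts with associations of values $u$ and $w$, then $u+w$ is defined and equal to $r$. A sum $p_1+\dots+p_n$ is \emph{defined}, with value $r$, if for some $z_1,\dots,z_k\in P$ the multiset $\{p_1,\dots,p_n,z_1,-z_1,\dots,z_k,-z_k\}$ has an association with value $r$. The determinant of a square matrix over $P$ is \emph{defined} if the sum $\sum_\sigma \mathrm{sgn}(\sigma)\prod_i a_{i\sigma(i)}$ is. A finite matroid $M$ with ground set $E$ is \emph{representable over} $P$ if for some $r$ there is an $r\times E$ matrix $A$ over $P$ such that the determinants of all square submatrices of $A$ are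 defined, the largest size of a square submatrix with nonzero determinant is $r$, and the bases of $M$ are exactly the $r$-element sets $B\subseteq E$ for which the submatrix of $A$ with column set $B$ has nonzero determinant. Every field is a partial field. For partial fields $P_1,P_2$, the partial field $P_1\otimes P_2$ is the set of pairs $(p_1,p_2)\in P_1\times P_2$ with $p_1\ne 0$ if and only if $p_2\neq 0$, with componentwise multiplication, and with $(p_1,p_2)+(q_1,q_2)=(p_1+q_1,p_2+q_2)$, defined if and only if both sums are defined and they are both zero or both nonzero. Let $\tau$ be the positive root of $x^2-x-1=0$. The \emph{golden ratio partial field} $\mathbb{G}=\mathbb{P}(\mathbb{R},\tau)$ is the set $\{0\}\cup\{\pm\tau^k: k\in\mathbb{Z}\}$ with the multiplication of $\mathbb{R}$ and with the addition of $\mathbb{R}$ restricted to those pairs whose sum is in this set. \textbf{Theorem (Vertigan).} Let $M$ be a finite matroid. The following are equivalent: (i) $M$ is representable over $\mathrm{GF}(4)\otimes\mathrm{GF}(5)$; (ii) $M$ is representable over $\mathbb{G}$; (iii) $M$ is representable over $\mathrm{GF}(5)$, over $\mathrm{GF}(p^2)$ for all primes $p$, and over $\mathrm{GF}(p)$ for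 all primes $p$ with $p\equiv\pm1 \pmod 5$. -/

import Mathlib

universe u v w

/-- `Association add S r`: there is an association of the multiset `S` whose root is labelled `r`,
that is, a labelled binary tree whose leaves are labelled by the members of `S`, in which the label
of every other vertex is the (defined) partial sum of the labels of its two children. -/
inductive Association {P : Type u} (add : P → P → Part P) : Multiset P → P → Prop
  | leaf (p : P) : Association add {p} p
  | node {S T : Multiset P} {u w r : P} :
      Association add S u → Association add T w → r ∈ add u w → Association add (S + T) r

/-- Partial fields. `padd` is the partial addition: `r ∈ padd p q` says that `p + q` is defined
and equal to `r`. That `P \ {0}` is an abelian group is `CommGroupWithZero`. -/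
class PartialField (P : Type u) extends CommGroupWithZero P, Neg P where
  padd : P → P → Part P
  padd_zero : ∀ p : P, padd p 0 = Part.some p
  zero_mem_padd_neg : ∀ p : P, 0 ∈ padd p (-p)
  eq_neg_of_zero_mem_padd : ∀ p q : P, 0 ∈ padd p q → q = -p
  padd_comm : ∀ p q r : P, r ∈ padd p q → r ∈ padd q p
  /-- `p * (q + r)` is defined if and only if `p * q + p * r` is, and then they are equal. (For
  `p = 0` the second sum is always defined, so the equivalence is one about `p ≠ 0`.) -/
  mul_padd : ∀ p q r : P, p ≠ 0 → padd (p * q) (p * r) = (padd q r).map (fun s => p * s)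
  /-- The associative law: if `S + T` has an association with root label `r`, then every
  pre-association of `S + T`, whose root has children labelled `u` and `w`, is compatible
  with it. -/
  padd_assoc : ∀ (S T : Multiset P) (r u w : P), Association padd (S + T) r →
    Association padd S u → Association padd T w → r ∈ padd u w

namespace PartialField

section Matrices

variable {P : Type u} [PartialField P]

/-- The sum of the members of `S` is defined and equal to `r`: some multiset
`S ∪ {z₁, -z₁, …, zₖ, -zₖ}` has an association with root label `r`. -/
def SumsTo (S : Multiset P) (r : P) : Prop :=
  ∃ Z : Multiset P, Association padd (S + (Z + Z.map (fun z => -z))) r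

/-- The terms `sign(σ) * ∏ i, A i (σ i)` of the determinant. -/
def detTerms {n : Type v} [Fintype n] [DecidableEq n] (A : Matrix n n P) : Multiset P :=
  (Finset.univ : Finset (Equiv.Perm n)).val.map
    (fun σ => if Equiv.Perm.sign σ = 1 then ∏ i, A i (σ i) else -∏ i, A i (σ i))

/-- `det A` is defined and equal to `d`. -/
def HasDet {n : Type v} [Fintype n] [DecidableEq n] (A : Matrix n n P) (d : P) : Prop :=
  SumsTo (detTerms A) d

/-- Matrices over a partial field all of whose subdeterminants are defined. -/
def IsPMatrix {X : Type v} {Y : Type w} (A : Matrix X Y P) : Prop :=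
  ∀ (k : ℕ) (f : Fin k ↪ X) (g : Fin k ↪ Y), ∃ d : P, HasDet (A.submatrix f g) d

/-- The largest size of a square submatrix with nonzero determinant. -/
noncomputable def rank {X : Type v} {Y : Type w} (A : Matrix X Y P) : ℕ :=
  sSup {k : ℕ | ∃ (f : Fin k ↪ X) (g : Fin k ↪ Y) (d : P), HasDet (A.submatrix f g) d ∧ d ≠ 0}

/-- The sets `B` of `r` columns of an `r × E` matrix `A` such that `det A[r, B] ≠ 0`. -/
def bases {r : ℕ} {E : Type w} (A : Matrix (Fin r) E P) : Set (Set E) :=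
  {B | ∃ g : Fin r ↪ E, Set.range g = B ∧ ∃ d : P, HasDet (A.submatrix id g) d ∧ d ≠ 0}

/-- Two associations of the same multiset have the same root label. -/
theorem association_unique {S : Multiset P} {r s : P}
    (hr : Association padd S r) (hs : Association padd S s) : r = s := by
  have h0 : Association padd ({0} : Multiset P) (0 : P) := Association.leaf 0
  have h1 : Association padd (S + {0}) r :=
    Association.node hr h0 (by rw [padd_zero]; exact Part.mem_some r)
  have h2 := padd_assoc S {0} r s 0 h1 hs h0
  rw [padd_zero] at h2
  exact Part.mem_some_iff.1 h2

theorem association_zero (Z : Multiset P) :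
    Association padd (Z + Z.map (fun z => -z) + {0}) (0 : P) := by
  induction Z using Multiset.induction_on with
  | empty => simpa using Association.leaf (add := padd) (0 : P)
  | cons a Z ih =>
    have h1 : Association padd (({a} : Multiset P) + {-a}) (0 : P) :=
      Association.node (Association.leaf a) (Association.leaf (-a)) (zero_mem_padd_neg a)
    have h2 := Association.node h1 ih (r := 0) (by rw [padd_zero]; exact Part.mem_some 0)
    convert h2 using 1
    rw [Multiset.map_cons, ← Multiset.singleton_add, ← Multiset.singleton_add]
    abel

/-- The value of a defined sum does not depend on the choices. -/
theorem SumsTo.unique {S : Multiset P} {r s : P} (hr : SumsTo S r) (hs : SumsTo S s) : r = s := by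
  obtain ⟨Z, hZ⟩ := hr
  obtain ⟨W, hW⟩ := hs
  have h1 := Association.node hZ (association_zero W) (r := r)
    (by rw [padd_zero]; exact Part.mem_some r)
  have h2 := Association.node hW (association_zero Z) (r := s)
    (by rw [padd_zero]; exact Part.mem_some s)
  refine association_unique h1 ?_
  convert h2 using 1
  abel

end Matrices

/-- Every field is a partial field, with its total addition. -/
instance ofField (F : Type u) [Field F] : PartialField F where
  toCommGroupWithZero := inferInstance
  toNeg := inferInstance
  padd p q := Part.some (p + q)
  padd_zero p := by simp
  zero_mem_padd_neg p := by simp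
  eq_neg_of_zero_mem_padd p q h := by
    rw [Part.mem_some_iff] at h
    exact (neg_eq_of_add_eq_zero_right h.symm).symm
  padd_comm p q r h := by rwa [add_comm]
  mul_padd p q r _ := by simp [mul_add]
  padd_assoc S T r u w h hS hT := by
    have key : ∀ {S : Multiset F} {r : F},
        Association (fun p q : F => Part.some (p + q)) S r → r = S.sum := by
      intro S r h
      induction h with
      | leaf p => simp
      | node _ _ h3 ih1 ih2 => rw [Part.mem_some_iff] at h3; simp [h3, ih1, ih2]
    simp [key h, key hS, key hT]

section OfRing

/-- The set `⟨S ∪ {-1}⟩ ∪ {0}`. -/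
def carrier {R : Type u} [CommRing R] (S : Set Rˣ) : Set R :=
  {x | x = 0 ∨ ∃ u ∈ Subgroup.closure (S ∪ {-1}), (u : R) = x}

/-- The type underlying the partial field `ℙ(R, S)`. -/
def OfRing (R : Type u) [CommRing R] (S : Set Rˣ) : Type u :=
  {x : R // x ∈ carrier S}

/-- Addition in `ℙ(R, S)`: that of `R`, defined when the result is in `⟨S ∪ {-1}⟩ ∪ {0}`. -/
def OfRing.padd {R : Type u} [CommRing R] {S : Set Rˣ} (p q : OfRing R S) : Part (OfRing R S) where
  Dom := p.1 + q.1 ∈ carrier S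
  get h := ⟨p.1 + q.1, h⟩

theorem OfRing.mem_padd {R : Type u} [CommRing R] {S : Set Rˣ} {p q r : OfRing R S} :
    r ∈ OfRing.padd p q ↔ r.1 = p.1 + q.1 := by
  constructor
  · rintro ⟨_, rfl⟩
    rfl
  · intro h
    exact ⟨show p.1 + q.1 ∈ carrier S from h ▸ r.2, Subtype.ext h.symm⟩

theorem OfRing.association {R : Type u} [CommRing R] {S : Set Rˣ} {A : Multiset (OfRing R S)}
    {r : OfRing R S} (h : Association OfRing.padd A r) :
    r.1 = (A.map fun p => p.1).sum := by
  induction h with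
  | leaf p => rw [Multiset.map_singleton, Multiset.sum_singleton]
  | node _ _ h3 ih1 ih2 =>
    rw [OfRing.mem_padd.1 h3, ih1, ih2, Multiset.map_add, Multiset.sum_add]

variable {R : Type u} [CommRing R] [Nontrivial R] {S : Set Rˣ}

/-- `ℙ(R, S)`: multiplication and addition are the restrictions of those of `R`. -/
noncomputable instance : PartialField (OfRing R S) where
  mul p q := ⟨p.1 * q.1, by
    obtain ⟨x, rfl | ⟨u, hu, rfl⟩⟩ := p
    · exact Or.inl (zero_mul _)
    obtain ⟨y, rfl | ⟨v, hv, rfl⟩⟩ := q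
    · exact Or.inl (mul_zero _)
    exact Or.inr ⟨u * v, mul_mem hu hv, by simp⟩⟩
  one := ⟨1, Or.inr ⟨1, one_mem _, rfl⟩⟩
  zero := ⟨0, Or.inl rfl⟩
  inv p := ⟨Ring.inverse p.1, by
    obtain ⟨x, rfl | ⟨u, hu, rfl⟩⟩ := p
    · exact Or.inl (Ring.inverse_zero R)
    exact Or.inr ⟨u⁻¹, inv_mem hu, by simp⟩⟩
  neg p := ⟨-p.1, by
    obtain ⟨x, rfl | ⟨u, hu, rfl⟩⟩ := p
    · exact Or.inl neg_zero
    exact Or.inr ⟨-1 * u, mul_mem (Subgroup.subset_closure (Or.inr rfl)) hu, by simp⟩⟩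
  mul_assoc p q r := Subtype.ext (mul_assoc _ _ _)
  one_mul p := Subtype.ext (one_mul _)
  mul_one p := Subtype.ext (mul_one _)
  mul_comm p q := Subtype.ext (mul_comm _ _)
  zero_mul p := Subtype.ext (zero_mul _)
  mul_zero p := Subtype.ext (mul_zero _)
  exists_pair_ne := ⟨⟨0, Or.inl rfl⟩, ⟨1, Or.inr ⟨1, one_mem _, rfl⟩⟩,
    fun h => zero_ne_one (congrArg Subtype.val h)⟩
  inv_zero := Subtype.ext (Ring.inverse_zero R)
  mul_inv_cancel p hp := by
    obtain ⟨x, rfl | ⟨u, hu, rfl⟩⟩ := p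
    · exact absurd rfl hp
    exact Subtype.ext (Ring.mul_inverse_cancel _ u.isUnit)
  padd := OfRing.padd
  padd_zero p := Part.eq_some_iff.2 (OfRing.mem_padd.2 (add_zero p.1).symm)
  zero_mem_padd_neg p := OfRing.mem_padd.2 (add_neg_cancel p.1).symm
  eq_neg_of_zero_mem_padd p q h :=
    Subtype.ext (neg_eq_of_add_eq_zero_right (OfRing.mem_padd.1 h).symm).symm
  padd_comm p q r h := OfRing.mem_padd.2 ((OfRing.mem_padd.1 h).trans (add_comm _ _))
  mul_padd p q r hp := by
    obtain ⟨x, rfl | ⟨u, hu, rfl⟩⟩ := p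
    · exact absurd rfl hp
    refine Part.ext' ?_ (fun _ _ => Subtype.ext (mul_add _ _ _).symm)
    change (u : R) * q.1 + u * r.1 ∈ carrier S ↔ q.1 + r.1 ∈ carrier S
    rw [← mul_add]
    constructor
    · rintro (h | ⟨v, hv, h⟩)
      · exact Or.inl (u.mul_right_eq_zero.1 h)
      · exact Or.inr ⟨u⁻¹ * v, mul_mem (inv_mem hu) hv, by simp [h]⟩
    · rintro (h | ⟨v, hv, h⟩)
      · exact Or.inl (u.mul_right_eq_zero.2 h)
      · exact Or.inr ⟨u * v, mul_mem hu hv, by simp [h]⟩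
  padd_assoc A B r u w h hA hB := by
    rw [OfRing.mem_padd, OfRing.association h, OfRing.association hA, OfRing.association hB,
      Multiset.map_add, Multiset.sum_add]

end OfRing

section Product

/-- The set of pairs underlying the product `P₁ ⊗ P₂` of partial fields. -/
def Product (P₁ : Type u) (P₂ : Type v) [PartialField P₁] [PartialField P₂] : Type (max u v) :=
  {p : P₁ × P₂ // p.1 ≠ 0 ↔ p.2 ≠ 0}

variable {P₁ : Type u} {P₂ : Type v} [PartialField P₁] [PartialField P₂]

/-- Componentwise addition, defined when both sums are, and both are zero or both nonzero. -/
def Product.padd (p q : Product P₁ P₂) : Part (Product P₁ P₂) where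
  Dom := ∃ (h₁ : (PartialField.padd p.1.1 q.1.1).Dom) (h₂ : (PartialField.padd p.1.2 q.1.2).Dom),
    (PartialField.padd p.1.1 q.1.1).get h₁ ≠ 0 ↔ (PartialField.padd p.1.2 q.1.2).get h₂ ≠ 0
  get h := ⟨((PartialField.padd p.1.1 q.1.1).get h.1, (PartialField.padd p.1.2 q.1.2).get h.2.1),
    h.2.2⟩

theorem Product.mem_padd {p q r : Product P₁ P₂} : r ∈ Product.padd p q ↔
    r.1.1 ∈ PartialField.padd p.1.1 q.1.1 ∧ r.1.2 ∈ PartialField.padd p.1.2 q.1.2 := by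
  constructor
  · rintro ⟨⟨h1, h2, h3⟩, rfl⟩
    exact ⟨⟨h1, rfl⟩, ⟨h2, rfl⟩⟩
  · rintro ⟨⟨h1, e1⟩, ⟨h2, e2⟩⟩
    refine ⟨⟨h1, h2, ?_⟩, Subtype.ext (Prod.ext e1 e2)⟩
    rw [e1, e2]
    exact r.2

theorem Product.association {A : Multiset (Product P₁ P₂)} {r : Product P₁ P₂}
    (h : Association Product.padd A r) :
    Association PartialField.padd (A.map fun p => p.1.1) r.1.1 ∧
      Association PartialField.padd (A.map fun p => p.1.2) r.1.2 := by
  induction h with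
  | leaf p => simpa using ⟨Association.leaf _, Association.leaf _⟩
  | node _ _ h3 ih1 ih2 =>
    rw [Product.mem_padd] at h3
    simp only [Multiset.map_add]
    exact ⟨.node ih1.1 ih2.1 h3.1, .node ih1.2 ih2.2 h3.2⟩

theorem neg_ne_zero_iff {P : Type u} [PartialField P] (p : P) : -p ≠ 0 ↔ p ≠ 0 := by
  have h := zero_mem_padd_neg p
  refine not_congr ⟨fun e => ?_, fun e => ?_⟩
  · rw [e, padd_zero] at h
    exact (Part.mem_some_iff.1 h).symm
  · subst e
    have h' := padd_comm _ _ _ h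
    rw [padd_zero] at h'
    exact (Part.mem_some_iff.1 h').symm

/-- The product `P₁ ⊗ P₂`, with componentwise operations. -/
instance : PartialField (Product P₁ P₂) where
  mul p q := ⟨(p.1.1 * q.1.1, p.1.2 * q.1.2), by
    have := p.2; have := q.2; simp only [mul_ne_zero_iff]; tauto⟩
  one := ⟨(1, 1), by simp⟩
  zero := ⟨(0, 0), by simp⟩
  inv p := ⟨(p.1.1⁻¹, p.1.2⁻¹), by have := p.2; simpa using this⟩
  neg p := ⟨(-p.1.1, -p.1.2), by
    simp only [neg_ne_zero_iff]; exact p.2⟩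
  mul_assoc p q r := Subtype.ext (Prod.ext (mul_assoc _ _ _) (mul_assoc _ _ _))
  one_mul p := Subtype.ext (Prod.ext (one_mul _) (one_mul _))
  mul_one p := Subtype.ext (Prod.ext (mul_one _) (mul_one _))
  mul_comm p q := Subtype.ext (Prod.ext (mul_comm _ _) (mul_comm _ _))
  zero_mul p := Subtype.ext (Prod.ext (zero_mul _) (zero_mul _))
  mul_zero p := Subtype.ext (Prod.ext (mul_zero _) (mul_zero _))
  exists_pair_ne := ⟨⟨(0, 0), by simp⟩, ⟨(1, 1), by simp⟩,
    fun h => zero_ne_one (congrArg (fun p => p.1.1) h)⟩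
  inv_zero := Subtype.ext (Prod.ext inv_zero inv_zero)
  mul_inv_cancel p hp := by
    have h1 : p.1.1 ≠ 0 := fun h => hp (Subtype.ext (Prod.ext h (by
      by_contra h2; exact p.2.2 h2 h)))
    exact Subtype.ext (Prod.ext (mul_inv_cancel₀ h1) (mul_inv_cancel₀ (p.2.1 h1)))
  padd := Product.padd
  padd_zero p := by
    refine Part.eq_some_iff.2 (Product.mem_padd.2 ⟨?_, ?_⟩)
    · exact Part.eq_some_iff.1 (padd_zero p.1.1)
    · exact Part.eq_some_iff.1 (padd_zero p.1.2)
  zero_mem_padd_neg p := Product.mem_padd.2 ⟨zero_mem_padd_neg _, zero_mem_padd_neg _⟩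
  eq_neg_of_zero_mem_padd p q h := by
    have := Product.mem_padd.1 h
    exact Subtype.ext (Prod.ext (eq_neg_of_zero_mem_padd _ _ this.1)
      (eq_neg_of_zero_mem_padd _ _ this.2))
  padd_comm p q r h := by
    have := Product.mem_padd.1 h
    exact Product.mem_padd.2 ⟨padd_comm _ _ _ this.1, padd_comm _ _ _ this.2⟩
  mul_padd p q r hp := by
    have h1 : p.1.1 ≠ 0 := fun h => hp (Subtype.ext (Prod.ext h (by
      by_contra h2; exact p.2.2 h2 h)))
    have h2 := p.2.1 h1
    ext s
    rw [Part.mem_map_iff, Product.mem_padd]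
    change s.1.1 ∈ PartialField.padd (p.1.1 * q.1.1) (p.1.1 * r.1.1) ∧
      s.1.2 ∈ PartialField.padd (p.1.2 * q.1.2) (p.1.2 * r.1.2) ↔ _
    rw [mul_padd _ _ _ h1, mul_padd _ _ _ h2, Part.mem_map_iff, Part.mem_map_iff]
    constructor
    · rintro ⟨⟨a, ha, ea⟩, ⟨b, hb, eb⟩⟩
      have hs := s.2
      rw [← ea, ← eb, mul_ne_zero_iff, mul_ne_zero_iff] at hs
      exact ⟨⟨(a, b), by tauto⟩, Product.mem_padd.2 ⟨ha, hb⟩, Subtype.ext (Prod.ext ea eb)⟩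
    · rintro ⟨t, ht, rfl⟩
      have := Product.mem_padd.1 ht
      exact ⟨⟨_, this.1, rfl⟩, ⟨_, this.2, rfl⟩⟩
  padd_assoc A B r u w h hA hB := by
    have h' := Product.association h
    have hA' := Product.association hA
    have hB' := Product.association hB
    simp only [Multiset.map_add] at h'
    exact Product.mem_padd.2 ⟨padd_assoc _ _ _ _ _ h'.1 hA'.1 hB'.1,
      padd_assoc _ _ _ _ _ h'.2 hA'.2 hB'.2⟩

end Product

end PartialField

/-- The golden ratio partial field `𝔾 = ℙ(ℝ, {τ})`. -/
abbrev GoldenRatioPartialField : Type :=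
  PartialField.OfRing ℝ {Units.mk0 Real.goldenRatio Real.goldenRatio_ne_zero}

/-- `M` is representable over the partial field `P`: `M = M[A]` for some `r × E` matrix `A` over
`P`, of rank `r`, all of whose subdeterminants are defined. Here `E` is the ground set of `M`. -/
def Matroid.IsRepresentableOver {α : Type v} (M : Matroid α) (P : Type u) [PartialField P] : Prop :=
  ∃ (r : ℕ) (A : Matrix (Fin r) M.E P), PartialField.IsPMatrix A ∧ PartialField.rank A = r ∧
    ∀ B : Set M.E, M.IsBase ((↑) '' B : Set α) ↔ B ∈ PartialField.bases A

instance factPrimeFive : Fact (Nat.Prime 5) := ⟨by norm_num⟩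

/-!
Send a partial field `P` to a commutative ring `R` by a multiplicative map respecting the sums that
are defined. Then determinants over `P` map to determinants over `R`, and (ii) ⇒ (iii) follows from
the ring homomorphisms from `ℤ[τ]` to a field `F` given by the roots of `x² = 1 + x` in `F`.
Conversely, if all the minors of a matrix over `R` come from `P`, then the matrix lifts to `P` with
all its determinants defined. For (iii) ⇒ (i) one takes the two representations to be identity
matrices on the same base, so that they combine to a matrix over `GF(4) × GF(5)`.

(i) ⇒ (ii) is the lifting theorem of Pendavingh and Van Zwam applied to the homomorphism from
`ℤ[τ]` to `GF(4) × GF(5)`. The fundamental elements of `𝔾`, those `f` for which `1 - f` is again in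
`𝔾`, can be lifted uniquely and compatibly with products equal to `1`. To lift a matrix one lifts it
with a row or column removed, by induction, and compares the two lifts of what remains; pivoting
reduces the question to the `2 × 2` minors, which are governed by the cross ratios.
-/

namespace PartialField

open Matrix

section UnitOrZero

variable {R : Type*} [CommRing R]

/-- `x ∈ H ∪ {0}` for a group `H` of units of `R`: the elements of the partial field `(R, H)`, seen
inside the ring `R`. -/
def UnitOrZero (H : Subgroup Rˣ) (x : R) : Prop :=
  x = 0 ∨ ∃ u ∈ H, (u : R) = x

namespace UnitOrZero

variable {H : Subgroup Rˣ} {x y : R}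

theorem zero : UnitOrZero H (0 : R) := Or.inl rfl

theorem one : UnitOrZero H (1 : R) := Or.inr ⟨1, one_mem _, rfl⟩

theorem of_mem {u : Rˣ} (hu : u ∈ H) : UnitOrZero H (u : R) := Or.inr ⟨u, hu, rfl⟩

theorem mul (hx : UnitOrZero H x) (hy : UnitOrZero H y) : UnitOrZero H (x * y) := by
  obtain rfl | ⟨u, hu, rfl⟩ := hx
  · simpa using zero
  obtain rfl | ⟨v, hv, rfl⟩ := hy
  · simpa using zero
  exact Or.inr ⟨u * v, mul_mem hu hv, by simp⟩

theorem neg (hH : -1 ∈ H) (hx : UnitOrZero H x) : UnitOrZero H (-x) := by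
  simpa using (of_mem hH).mul hx

theorem neg_one_pow (hH : -1 ∈ H) (n : ℕ) : UnitOrZero H ((-1 : R) ^ n) :=
  Or.inr ⟨(-1) ^ n, pow_mem hH n, by simp⟩

theorem sub_comm (hH : -1 ∈ H) (h : UnitOrZero H (x - y)) : UnitOrZero H (y - x) := by
  simpa using h.neg hH

theorem sub_of_eq_zero (hH : -1 ∈ H) (hx : UnitOrZero H x) (hy : UnitOrZero H y)
    (h : x = 0 ∨ y = 0) : UnitOrZero H (x - y) := by
  obtain rfl | rfl := h
  · simpa using hy.neg hH
  · simpa using hx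

theorem inverse (hx : UnitOrZero H x) : UnitOrZero H (Ring.inverse x) := by
  obtain rfl | ⟨u, hu, rfl⟩ := hx
  · simpa using zero
  exact Or.inr ⟨u⁻¹, inv_mem hu, by simp⟩

theorem isUnit (hx : UnitOrZero H x) (h : x ≠ 0) : IsUnit x := by
  obtain rfl | ⟨u, -, rfl⟩ := hx
  · exact absurd rfl h
  exact u.isUnit

theorem mul_inverse (hx : UnitOrZero H x) (h : x ≠ 0) : x * Ring.inverse x = 1 :=
  Ring.mul_inverse_cancel _ (hx.isUnit h)

theorem inverse_ne_zero [Nontrivial R] (hx : UnitOrZero H x) (h : x ≠ 0) : Ring.inverse x ≠ 0 :=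
  right_ne_zero_of_mul_eq_one (hx.mul_inverse h)

theorem mul_ne_zero (hx : UnitOrZero H x) (h : x ≠ 0) (h' : y ≠ 0) : x * y ≠ 0 :=
  fun h0 => h' ((hx.isUnit h).mul_right_eq_zero.1 h0)

theorem prod {ι : Type*} (s : Finset ι) (f : ι → R) (hf : ∀ i ∈ s, UnitOrZero H (f i)) :
    UnitOrZero H (∏ i ∈ s, f i) :=
  Finset.prod_induction f (UnitOrZero H) (fun _ _ => mul) one hf

end UnitOrZero

theorem map_ringInverse {R S : Type*} [CommRing R] [CommRing S] (φ : R →+* S) {x : R}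
    (hx : IsUnit x) : φ (Ring.inverse x) = Ring.inverse (φ x) := by
  obtain ⟨u, rfl⟩ := hx
  rw [Ring.inverse_unit]
  exact (Ring.inverse_unit (Units.map (φ : R →* S) u)).symm

end UnitOrZero

section Pivot

variable {R : Type*} [CommRing R] {X Y : Type*} [DecidableEq X] [DecidableEq Y]

/-- The pivot of `D` over the entry `(x, y)`. It exchanges the `x`-th column of `[I | D]` with the
`y`-th column of `D`; the labels `x` and `y` are not exchanged. -/
noncomputable def pivot (D : Matrix X Y R) (x : X) (y : Y) : Matrix X Y R := fun i j =>
  if i = x then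
    if j = y then Ring.inverse (D x y) else Ring.inverse (D x y) * D x j
  else
    if j = y then -(D i y * Ring.inverse (D x y))
    else D i j - D i y * Ring.inverse (D x y) * D x j

variable (D : Matrix X Y R) {x i : X} {y j : Y}

@[simp] theorem pivot_self : pivot D x y x y = Ring.inverse (D x y) := by simp [pivot]

theorem pivot_row (h : j ≠ y) : pivot D x y x j = Ring.inverse (D x y) * D x j := by
  simp [pivot, h]

theorem pivot_col (h : i ≠ x) : pivot D x y i y = -(D i y * Ring.inverse (D x y)) := by
  simp [pivot, h]

theorem pivot_of_ne (h : i ≠ x) (h' : j ≠ y) :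
    pivot D x y i j = D i j - D i y * Ring.inverse (D x y) * D x j := by
  simp [pivot, h, h']

theorem pivot_of_row_eq_zero (h : i ≠ x) (h0 : D i y = 0) : pivot D x y i j = D i j := by
  rcases eq_or_ne j y with rfl | hj
  · rw [pivot_col _ h, h0, zero_mul, neg_zero]
  · rw [pivot_of_ne _ h hj, h0, zero_mul, zero_mul, sub_zero]

theorem pivot_of_col_eq_zero (h : j ≠ y) (h0 : D x j = 0) : pivot D x y i j = D i j := by
  rcases eq_or_ne i x with rfl | hi
  · rw [pivot_row _ h, h0, mul_zero]
  · rw [pivot_of_ne _ hi h, h0, mul_zero, sub_zero]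

theorem pivot_pivot (hu : IsUnit (D x y)) : pivot (pivot D x y) x y = D := by
  have h1 := Ring.mul_inverse_cancel _ hu
  have h2 : Ring.inverse (Ring.inverse (D x y)) = D x y := by
    obtain ⟨u, hu⟩ := hu
    rw [← hu, Ring.inverse_unit, Ring.inverse_unit, inv_inv]
  ext i j
  rcases eq_or_ne i x with rfl | hi <;> rcases eq_or_ne j y with rfl | hj
  · rw [pivot_self, pivot_self, h2]
  · rw [pivot_row _ hj, pivot_self, pivot_row _ hj, h2]
    linear_combination D i j * h1
  · rw [pivot_col _ hi, pivot_self, pivot_col _ hi, h2]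
    linear_combination D i j * h1
  · rw [pivot_of_ne _ hi hj, pivot_self, pivot_col _ hi, pivot_row _ hj, pivot_of_ne _ hi hj, h2]
    linear_combination D i y * Ring.inverse (D x y) * D x j * h1

theorem pivot_map {S : Type*} [CommRing S] (φ : R →+* S) (hu : IsUnit (D x y)) :
    (pivot D x y).map φ = pivot (D.map φ) x y := by
  ext i j
  simp only [map_apply, pivot]
  split_ifs <;> simp [map_ringInverse φ hu]

theorem pivot_submatrix {X' Y' : Type*} [DecidableEq X'] [DecidableEq Y'] {f : X' → X}
    {g : Y' → Y} (hf : Function.Injective f) (hg : Function.Injective g) (x : X') (y : Y') :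
    pivot (D.submatrix f g) x y = (pivot D (f x) (g y)).submatrix f g := by
  ext i j
  simp [pivot, hf.eq_iff, hg.eq_iff]

theorem det_submatrix_eq_det_pivot {k : ℕ} {f : Fin (k + 1) → X} {g : Fin (k + 1) → Y}
    (hf : Function.Injective f) (hg : Function.Injective g) (i j : Fin (k + 1))
    (hu : IsUnit (D (f i) (g j))) :
    (D.submatrix f g).det = (-1) ^ (i + j : ℕ) * D (f i) (g j) *
      ((pivot D (f i) (g j)).submatrix (f ∘ i.succAbove) (g ∘ j.succAbove)).det := by
  let a := Ring.inverse (D (f i) (g j))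
  have ha : D (f i) (g j) * a = 1 := Ring.mul_inverse_cancel _ hu
  let c : Fin (k + 1) → R := fun l => if l = i then 0 else D (f l) (g j) * a
  let B : Matrix (Fin (k + 1)) (Fin (k + 1)) R := fun l m => D (f l) (g m) - c l * D (f i) (g m)
  have hB : B i j = D (f i) (g j) := by simp [B, c]
  have hB0 : ∀ l, l ≠ i → B l j = 0 := fun l hl => by
    simp only [B, c, if_neg hl]
    linear_combination (-D (f l) (g j)) * ha
  have hdet : (D.submatrix f g).det = B.det :=
    det_eq_of_forall_row_eq_smul_add_const c i (by simp [c]) fun l m => by simp [B, c]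
  rw [hdet, det_succ_column B j, Finset.sum_eq_single i (fun l _ hl => by simp [hB0 l hl])
    (by simp), hB]
  congr 2
  ext l m
  simp only [submatrix_apply, Function.comp_apply]
  rw [pivot_of_ne _ (hf.ne (Fin.succAbove_ne i l)) (hg.ne (Fin.succAbove_ne j m))]
  simp [B, c, a]

end Pivot

section Strong

variable {R : Type*} [CommRing R] (H : Subgroup Rˣ) {X Y : Type*}

/-- All square submatrices of `D` have determinants in `H ∪ {0}`; this makes `D` a matrix over the
partial field `(R, H)`. -/
def IsStrong (D : Matrix X Y R) : Prop :=
  ∀ (k : ℕ) (f : Fin k → X) (g : Fin k → Y), UnitOrZero H (D.submatrix f g).det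

variable {H}

theorem unitOrZero_det_of_injective {k : ℕ} (D : Matrix X Y R) (f : Fin k → X) (g : Fin k → Y)
    (h : f.Injective → g.Injective → UnitOrZero H (D.submatrix f g).det) :
    UnitOrZero H (D.submatrix f g).det := by
  by_cases hf : f.Injective
  · by_cases hg : g.Injective
    · exact h hf hg
    obtain ⟨a, b, hab, hne⟩ := Function.not_injective_iff.1 hg
    exact Or.inl (det_zero_of_column_eq hne fun m => by simp [hab])
  · obtain ⟨a, b, hab, hne⟩ := Function.not_injective_iff.1 hf
    exact Or.inl (det_zero_of_row_eq hne (by ext m; simp [hab]))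

namespace IsStrong

variable {D : Matrix X Y R}

theorem apply (h : IsStrong H D) (x : X) (y : Y) : UnitOrZero H (D x y) := by
  simpa using h 1 (fun _ => x) (fun _ => y)

theorem det_two (h : IsStrong H D) (x x' : X) (y y' : Y) :
    UnitOrZero H (D x y * D x' y' - D x y' * D x' y) := by
  have := h 2 ![x, x'] ![y, y']
  rw [det_fin_two] at this
  simpa only [submatrix_apply, cons_val_zero, cons_val_one] using this

theorem submatrix {X' Y' : Type*} (h : IsStrong H D) (f : X' → X) (g : Y' → Y) :
    IsStrong H (D.submatrix f g) := fun k f' g' => h k (f ∘ f') (g ∘ g')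

theorem transpose (h : IsStrong H D) : IsStrong H Dᵀ := by
  intro k f g
  rw [← transpose_submatrix, det_transpose]
  exact h k g f

theorem scale (h : IsStrong H D) {r : X → R} {c : Y → R} (hr : ∀ x, UnitOrZero H (r x))
    (hc : ∀ y, UnitOrZero H (c y)) : IsStrong H (of fun x y => r x * c y * D x y) := by
  intro k f g
  have : ((of fun x y => r x * c y * D x y).submatrix f g) =
      of fun i j => r (f i) * (of (fun i j => c (g j) * D.submatrix f g i j)) i j := by
    ext i j
    simp [mul_assoc]
  rw [this, det_mul_column, det_mul_row]
  exact (UnitOrZero.prod _ _ fun _ _ => hr _).mul ((UnitOrZero.prod _ _ fun _ _ => hc _).mul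
    (h k f g))

/- A column of `I` in the minor is expanded away; what is left is a minor of `D`. -/
theorem fromCols_one [DecidableEq X] (hH : -1 ∈ H) (h : IsStrong H D) :
    IsStrong H (fromCols (1 : Matrix X X R) D) := by
  intro k
  induction k with
  | zero => intro f g; simpa using UnitOrZero.one
  | succ k ih =>
    intro f g
    refine unitOrZero_det_of_injective _ f g fun hf _ => ?_
    by_cases hg : ∃ j x, g j = Sum.inl x
    · obtain ⟨j, x, hj⟩ := hg
      by_cases hx : ∃ i, f i = x
      · obtain ⟨i, rfl⟩ := hx
        rw [det_succ_column _ j, Finset.sum_eq_single i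
          (fun l _ hl => by simp [hj, hf.ne hl]) (by simp), submatrix_submatrix]
        simpa [hj] using (UnitOrZero.neg_one_pow hH _).mul (ih _ _)
      · push Not at hx
        exact Or.inl (det_eq_zero_of_column_eq_zero j fun i => by simp [hj, hx i])
    · have (j : Fin (k + 1)) : ∃ y, g j = Sum.inr y := by
        rcases hgj : g j with x | y
        · exact absurd ⟨j, x, hgj⟩ hg
        · exact ⟨y, rfl⟩
      choose g' hg' using this
      convert h (k + 1) f g' using 2
      ext i j
      simp [hg']

variable [DecidableEq X] [DecidableEq Y]

theorem det_pivot_of_notMem (h : IsStrong H D) {x : X} {y : Y} (hxy : D x y ≠ 0)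
    {k : ℕ} {f : Fin k → X} {g : Fin k → Y} (hf : ∀ i, f i ≠ x) (hg : ∀ j, g j ≠ y) :
    UnitOrZero H ((pivot D x y).submatrix f g).det := by
  refine unitOrZero_det_of_injective _ f g fun hf' hg' => ?_
  have hu := (h.apply x y).isUnit hxy
  have hdet := det_submatrix_eq_det_pivot D (f := Fin.cons x f) (g := Fin.cons y g)
    (Fin.cons_injective_iff.2 ⟨by simpa using hf, hf'⟩)
    (Fin.cons_injective_iff.2 ⟨by simpa using hg, hg'⟩) 0 0 hu
  have hcomp : ((pivot D x y).submatrix f g).det =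
      Ring.inverse (D x y) * (D.submatrix (Fin.cons x f : Fin (k + 1) → X) (Fin.cons y g)).det := by
    rw [hdet]
    simp only [Fin.cons_zero, Fin.val_zero, add_zero, pow_zero, one_mul, Fin.succAbove_zero]
    rw [← mul_assoc, Ring.inverse_mul_cancel _ hu, one_mul]
    rfl
  rw [hcomp]
  exact (h.apply x y).inverse.mul (h _ _ _)

/- The pivot is, up to the sign of its row `x`, the Schur complement of the entry `D x y` in the
matrix that arises from `D` by bordering it with the unit column `x` and the unit row `y`. -/
protected theorem pivot (hH : -1 ∈ H) (h : IsStrong H D) {x : X} {y : Y} (hxy : D x y ≠ 0) :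
    IsStrong H (pivot D x y) := by
  let N : Matrix ((X ⊕ Y) ⊕ X) (X ⊕ Y) R := (fromCols 1 (fromCols 1 D)ᵀ)ᵀ
  let M : Matrix (Option X) (Option Y) R := N.submatrix
    (fun i => i.elim (.inr x) fun i => if i = x then .inl (.inr y) else .inr i)
    (fun j => j.elim (.inr y) fun j => if j = y then .inl x else .inr j)
  have hM : IsStrong H M :=
    (((h.fromCols_one hH).transpose.fromCols_one hH).transpose).submatrix _ _
  have hS : IsStrong H ((pivot M none none).submatrix some some) := fun k f g => by
    rw [submatrix_submatrix]
    exact hM.det_pivot_of_notMem (x := none) (y := none) hxy (by simp) (by simp)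
  convert hS.scale (r := fun i => if i = x then -1 else 1) (c := 1)
    (fun i => by split_ifs; exacts [UnitOrZero.one.neg hH, .one]) (fun _ => .one) using 1
  ext i j
  by_cases hi : i = x <;> by_cases hj : j = y <;>
    simp [pivot, M, N, hi, hj, one_apply]

end IsStrong

theorem isStrong_of_pivot_closed [DecidableEq X] [DecidableEq Y] (hH : -1 ∈ H)
    (C : Set (Matrix X Y R)) (h1 : ∀ D ∈ C, ∀ x y, UnitOrZero H (D x y))
    (h2 : ∀ D ∈ C, ∀ x y, D x y ≠ 0 → pivot D x y ∈ C) {D : Matrix X Y R} (hD : D ∈ C) :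
    IsStrong H D := by
  intro k
  induction k generalizing D with
  | zero => intro f g; simpa using UnitOrZero.one
  | succ k ih =>
    intro f g
    refine unitOrZero_det_of_injective D f g fun hf hg => ?_
    by_cases h0 : ∀ i, D (f i) (g 0) = 0
    · exact Or.inl (det_eq_zero_of_column_eq_zero 0 (by simpa using h0))
    push Not at h0
    obtain ⟨i, hi⟩ := h0
    rw [det_submatrix_eq_det_pivot D hf hg i 0 ((h1 D hD _ _).isUnit hi)]
    exact ((UnitOrZero.neg_one_pow hH _).mul (h1 D hD _ _)).mul (ih (h2 D hD _ _ hi) _ _)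

/- The minor of `D` with rows `f` and columns `g` is the maximal minor of `[I | D]` in which the
columns `f` of `I` are replaced with the columns `g` of `D`. -/
theorem isStrong_of_det_fromCols_one [DecidableEq X] [Fintype X] {D : Matrix X Y R}
    (h : ∀ g : X → X ⊕ Y, UnitOrZero H ((fromCols (1 : Matrix X X R) D).submatrix id g).det) :
    IsStrong H D := by
  intro k f g
  refine unitOrZero_det_of_injective D f g fun hf _ => ?_
  classical
  let e := Equiv.ofInjective f hf
  let c : X → X ⊕ Y := fun x =>
    if hx : x ∈ Set.range f then .inr (g (e.symm ⟨x, hx⟩)) else .inl x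
  have hc_mem (i : Fin k) : c (f i) = .inr (g i) := by simp [c, e]
  have hc_notMem (x : X) (hx : x ∉ Set.range f) : c x = .inl x := dif_neg hx
  let M := (fromCols (1 : Matrix X X R) D).submatrix id c
  have hM : M.det = (D.submatrix f g).det := by
    rw [twoBlockTriangular_det' M (· ∈ Set.range f) fun i hi j hj => by
      simp [M, hc_notMem j hj, one_apply, ne_of_mem_of_not_mem hi hj]]
    have hin : toSquareBlockProp M (· ∈ Set.range f) =
        (D.submatrix f g).submatrix e.symm e.symm := by
      ext ⟨_, i, rfl⟩ ⟨_, j, rfl⟩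
      have he (l : Fin k) : e.symm ⟨f l, l, rfl⟩ = l := Equiv.ofInjective_symm_apply hf l
      simp [toSquareBlockProp, M, hc_mem, he]
    have hout : toSquareBlockProp M (· ∉ Set.range f) = 1 := by
      ext i j
      simp [toSquareBlockProp, M, hc_notMem _ j.2, one_apply, Subtype.ext_iff]
    rw [hin, hout, det_one, mul_one]
    convert det_submatrix_equiv_self e.symm _
  rw [← hM]
  exact h c

end Strong

section Fundamental

variable {R : Type*} [CommRing R] (H : Subgroup Rˣ) {X Y : Type*}

/-- The fundamental elements of the partial field `(R, H)`: the nonzero `f ∈ H ∪ {0}` for which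
`1 - f ∈ H ∪ {0}`. They are the cross ratios of strong matrices. -/
structure IsFundamental (f : R) : Prop where
  unitOrZero : UnitOrZero H f
  ne_zero : f ≠ 0
  one_sub : UnitOrZero H (1 - f)

/-- The cross ratio `D x y * D x' y' / (D x y' * D x' y)` is fundamental. It is written as a product
because the entries need not be invertible. -/
def HasFundamentalRatio (D : Matrix X Y R) (x x' : X) (y y' : Y) : Prop :=
  ∃ f, IsFundamental H f ∧ f * (D x y' * D x' y) = D x y * D x' y'

variable {H}

namespace IsFundamental

variable {f : R}

theorem one [Nontrivial R] : IsFundamental H (1 : R) :=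
  ⟨.one, one_ne_zero, by simpa using UnitOrZero.zero⟩

theorem mul_inverse (h : IsFundamental H f) : f * Ring.inverse f = 1 :=
  h.unitOrZero.mul_inverse h.ne_zero

theorem inverse [Nontrivial R] (hH : -1 ∈ H) (h : IsFundamental H f) :
    IsFundamental H (Ring.inverse f) := by
  refine ⟨h.unitOrZero.inverse, h.unitOrZero.inverse_ne_zero h.ne_zero, ?_⟩
  convert (h.one_sub.mul h.unitOrZero.inverse).neg hH using 1
  linear_combination -h.mul_inverse

theorem one_sub_of_ne_one (h : IsFundamental H f) (hf : f ≠ 1) : IsFundamental H (1 - f) :=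
  ⟨h.one_sub, sub_ne_zero.2 hf.symm, by simpa using h.unitOrZero⟩

end IsFundamental

variable {D : Matrix X Y R} {x x' : X} {y y' : Y}

namespace HasFundamentalRatio

theorem refl [Nontrivial R] (D : Matrix X Y R) (x : X) (y y' : Y) :
    HasFundamentalRatio H D x x y y' :=
  ⟨1, .one, by ring⟩

variable [Nontrivial R] (hH : -1 ∈ H)

include hH

theorem swap_cols (h : HasFundamentalRatio H D x x' y y') : HasFundamentalRatio H D x x' y' y := by
  obtain ⟨f, hf, h⟩ := h
  exact ⟨_, hf.inverse hH,
    by linear_combination D x y' * D x' y * hf.mul_inverse - Ring.inverse f * h⟩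

theorem swap_rows (h : HasFundamentalRatio H D x x' y y') : HasFundamentalRatio H D x' x y y' := by
  obtain ⟨f, hf, h⟩ := h
  exact ⟨_, hf.inverse hH,
    by linear_combination D x y' * D x' y * hf.mul_inverse - Ring.inverse f * h⟩

omit [Nontrivial R] in
theorem det (hD : ∀ i j, UnitOrZero H (D i j)) (h : HasFundamentalRatio H D x x' y y') :
    UnitOrZero H (D x y * D x' y' - D x y' * D x' y) := by
  obtain ⟨f, hf, h⟩ := h
  convert (hf.one_sub.mul ((hD x y').mul (hD x' y))).neg hH using 1
  linear_combination -h

end HasFundamentalRatio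

theorem IsStrong.hasFundamentalRatio [Nontrivial R] (hH : -1 ∈ H) (hD : IsStrong H D)
    (hxy : D x y ≠ 0) (hxy' : D x y' ≠ 0) (hx'y : D x' y ≠ 0) (hx'y' : D x' y' ≠ 0) :
    HasFundamentalRatio H D x x' y y' := by
  let b := D x y' * D x' y
  have hb : UnitOrZero H b := (hD.apply _ _).mul (hD.apply _ _)
  have hb0 : b ≠ 0 := (hD.apply _ _).mul_ne_zero hxy' hx'y
  have hinv := hb.mul_inverse hb0
  have ha : UnitOrZero H (D x y * D x' y') := (hD.apply _ _).mul (hD.apply _ _)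
  have ha0 : D x y * D x' y' ≠ 0 := (hD.apply _ _).mul_ne_zero hxy hx'y'
  refine ⟨D x y * D x' y' * Ring.inverse b,
    ⟨ha.mul hb.inverse, ha.mul_ne_zero ha0 (hb.inverse_ne_zero hb0), ?_⟩, ?_⟩
  · convert ((hD.det_two x x' y y').mul hb.inverse).neg hH using 1
    linear_combination -hinv
  · linear_combination D x y * D x' y' * hinv

end Fundamental

section Lifting

variable {S R : Type*} [CommRing S] [CommRing R] {φ : S →+* R} {K : Subgroup Sˣ} {H : Subgroup Rˣ}

/-- The conditions on a homomorphism of partial fields `(S, K) → (R, H)` under which every strong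
matrix over the target lifts to the source: fundamental elements lift, and the relations `f g h = 1`
and `f + g = 0` between fundamental elements hold as soon as their images hold. -/
structure IsLifting (φ : S →+* R) (K : Subgroup Sˣ) (H : Subgroup Rˣ) : Prop where
  neg_one_mem_source : -1 ∈ K
  neg_one_mem_target : -1 ∈ H
  surj : ∀ u ∈ H, ∃ v ∈ K, φ (v : S) = u
  exists_fundamental : ∀ f, IsFundamental H f → ∃ g, IsFundamental K g ∧ φ g = f
  eq_one : ∀ f g h, IsFundamental K f → IsFundamental K g → IsFundamental K h →
    φ (f * g * h) = 1 → f * g * h = 1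
  eq_neg : ∀ f g, IsFundamental K f → IsFundamental K g → φ f = -φ g → f = -g

theorem UnitOrZero.map_eq_zero [Nontrivial R] {x : S} (hx : UnitOrZero K x) :
    φ x = 0 ↔ x = 0 := by
  refine ⟨fun h => ?_, fun h => by rw [h, map_zero]⟩
  by_contra h0
  exact ((hx.isUnit h0).map φ).ne_zero h

namespace IsLifting

variable [Nontrivial S] {f g : S}

theorem injOn (L : IsLifting φ K H) (hf : IsFundamental K f) (hg : IsFundamental K g)
    (h : φ f = φ g) : f = g := by
  have hfg := L.eq_one f (Ring.inverse g) 1 hf (hg.inverse L.neg_one_mem_source) .one (by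
    rw [mul_one, map_mul, h, ← map_mul, hg.mul_inverse, map_one])
  linear_combination g * hfg - f * hg.mul_inverse

theorem isFundamental_mul (L : IsLifting φ K H) (hf : IsFundamental K f) (hg : IsFundamental K g)
    (h : IsFundamental H (φ (f * g))) : IsFundamental K (f * g) := by
  obtain ⟨e, he, h⟩ := L.exists_fundamental _ h
  have hfg := L.eq_one f g (Ring.inverse e) hf hg (he.inverse L.neg_one_mem_source) (by
    rw [map_mul, ← h, ← map_mul, he.mul_inverse, map_one])
  convert he using 1
  linear_combination e * hfg - f * g * he.mul_inverse

end IsLifting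

end Lifting

section Chain

variable {R : Type*} [CommRing R] {X Y : Type*}

/-- A chain of `n + 1` rows of `D` in which consecutive rows have a common nonzero column in `T`,
that is, a walk of length `2 * n` in the bipartite graph of nonzero entries. -/
inductive Chain (D : Matrix X Y R) (T : Set Y) : ℕ → X → X → Prop
  | nil (x : X) : Chain D T 0 x x
  | cons {n : ℕ} {x x₁ x' : X} {y : Y} :
      y ∈ T → D x y ≠ 0 → D x₁ y ≠ 0 → Chain D T n x₁ x' → Chain D T (n + 1) x x'

namespace Chain

variable {D : Matrix X Y R} {T : Set Y} {m n : ℕ} {a b c : X}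

theorem trans (h : Chain D T m a b) (h' : Chain D T n b c) : Chain D T (m + n) a c := by
  induction h with
  | nil => rwa [Nat.zero_add]
  | cons hy h1 h2 _ ih => rw [Nat.add_right_comm]; exact .cons hy h1 h2 (ih h')

theorem symm (h : Chain D T m a b) : Chain D T m b a := by
  induction h with
  | nil => exact .nil _
  | cons hy h1 h2 _ ih => exact ih.trans (.cons hy h2 h1 (.nil _))

theorem map_columns {Y' : Type*} {D' : Matrix X Y' R} {T' : Set Y'} {g : Y → Y'}
    (hg : Set.MapsTo g T T') (hD : ∀ i, ∀ j ∈ T, D' i (g j) = D i j) (h : Chain D T m a b) :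
    Chain D' T' m a b := by
  induction h with
  | nil => exact .nil _
  | cons hy h1 h2 _ ih => exact .cons (hg hy) (by rwa [hD _ _ hy]) (by rwa [hD _ _ hy]) ih

theorem shortcut_or_persists (D' : Matrix X Y R) (y : Y)
    (hD' : ∀ i j, D i y = 0 → D' i j = D i j) (h : Chain D T m a b) :
    (∃ m' ≤ m, ∃ a', D a' y ≠ 0 ∧ Chain D T m' a' b) ∨
      (D a y = 0 ∧ D b y = 0 ∧ Chain D' T m a b) := by
  induction h with
  | nil x =>
    by_cases hx : D x y = 0
    · exact .inr ⟨hx, hx, .nil _⟩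
    · exact .inl ⟨0, le_rfl, x, hx, .nil _⟩
  | @cons n x x₁ x' z hz h1 h2 h ih =>
    by_cases hx : D x y = 0
    · obtain ⟨m', hm', a', ha', h'⟩ | ⟨h3, h4, h5⟩ := ih
      · exact .inl ⟨m', by omega, a', ha', h'⟩
      · exact .inr ⟨hx, h4, .cons hz (by rwa [hD' _ _ hx]) (by rwa [hD' _ _ h3]) h5⟩
    · exact .inl ⟨n + 1, le_rfl, x, hx, .cons hz h1 h2 h⟩

end Chain

variable [DecidableEq X] [DecidableEq Y] {H : Subgroup Rˣ} {D : Matrix X Y R}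

theorem pivot_ne_zero_of_eq_zero [Nontrivial R] (hD : ∀ i j, UnitOrZero H (D i j)) {x i : X}
    {y j : Y} (hij : D i j = 0) (hxy : D x y ≠ 0) (hxj : D x j ≠ 0) (hiy : D i y ≠ 0) :
    pivot D x y i j ≠ 0 := by
  have hi : i ≠ x := by rintro rfl; exact hxj hij
  have hj : j ≠ y := by rintro rfl; exact hiy hij
  rw [pivot_of_ne _ hi hj, hij, zero_sub, neg_ne_zero]
  exact ((hD _ _).mul (hD _ _).inverse).mul_ne_zero
    ((hD _ _).mul_ne_zero hiy ((hD _ _).inverse_ne_zero hxy)) hxj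

/- Unless there is a shortcut, the pivot is over the third row and the column that precedes it: this
removes that row from the chain and leaves the ends alone. -/
theorem Chain.exists_shorter_or_pivot [Nontrivial R] (hD : ∀ i j, UnitOrZero H (D i j)) {T : Set Y}
    {n : ℕ} {x x' : X} (h : Chain D T (n + 3) x x') :
    (∃ m ≤ n + 2, Chain D T m x x') ∨
      ∃ p, ∃ q ∈ T, D p q ≠ 0 ∧ D x q = 0 ∧ D x' q = 0 ∧ Chain (pivot D p q) T (n + 2) x x' := by
  obtain _ | @⟨_, _, x₁, _, y, hy, hxy, hx₁y, h₁⟩ := h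
  obtain _ | @⟨_, _, x₂, _, y₁, hy₁, hx₁y₁, hx₂y₁, h₂⟩ := h₁
  obtain _ | @⟨_, _, x₃, _, y₂, hy₂, hx₂y₂, hx₃y₂, h₃⟩ := h₂
  by_cases hxy₁ : D x y₁ = 0
  swap
  · exact .inl ⟨n + 2, le_rfl, .cons hy₁ hxy₁ hx₂y₁ (.cons hy₂ hx₂y₂ hx₃y₂ h₃)⟩
  by_cases hx₁y₂ : D x₁ y₂ = 0
  swap
  · exact .inl ⟨n + 2, le_rfl, .cons hy hxy hx₁y (.cons hy₂ hx₁y₂ hx₃y₂ h₃)⟩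
  by_cases hx₂y : D x₂ y = 0
  swap
  · exact .inl ⟨n + 2, le_rfl, .cons hy hxy hx₂y (.cons hy₂ hx₂y₂ hx₃y₂ h₃)⟩
  have hyy₁ : y ≠ y₁ := by rintro rfl; exact hxy hxy₁
  have hxx₂ : x ≠ x₂ := by rintro rfl; exact hxy hx₂y
  obtain ⟨m, hm, a, ha, h₄⟩ | ⟨hx₃y₁, hx'y₁, h₄⟩ := h₃.shortcut_or_persists (pivot D x₂ y₁) y₁
    fun i j hi => pivot_of_row_eq_zero D (by rintro rfl; exact hx₂y₁ hi) hi
  · exact .inl ⟨m + 2, by omega, .cons hy hxy hx₁y (.cons hy₁ hx₁y₁ ha h₄)⟩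
  have hx₃x₂ : x₃ ≠ x₂ := by rintro rfl; exact hx₂y₁ hx₃y₁
  refine .inr ⟨x₂, y₁, hy₁, hx₂y₁, hxy₁, hx'y₁,
    .cons (x₁ := x₁) hy ?_ ?_ (.cons hy₂ ?_ ?_ h₄)⟩
  · rwa [pivot_of_row_eq_zero _ hxx₂ hxy₁]
  · rwa [pivot_of_col_eq_zero _ hyy₁ hx₂y]
  · exact pivot_ne_zero_of_eq_zero hD hx₁y₂ hx₂y₁ hx₂y₂ hx₁y₁
  · rwa [pivot_of_row_eq_zero _ hx₃x₂ hx₃y₁]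

end Chain

section Glued

variable {S R : Type*} [CommRing S] [CommRing R] {φ : S →+* R} {K : Subgroup Sˣ} {H : Subgroup Rˣ}
  {X Y : Type*}

/-- The matrix `D` has a strong image under `φ`, and it is strong once one of the columns `u` and
`v` is deleted: what is known of a lift that is put together from lifts of the two deletions. -/
structure IsGlued (φ : S →+* R) (K : Subgroup Sˣ) (H : Subgroup Rˣ) (D : Matrix X Y S)
    (u v : Y) : Prop where
  ne : u ≠ v
  left : IsStrong K (D.submatrix id (Subtype.val : {j // j ≠ u} → Y))
  right : IsStrong K (D.submatrix id (Subtype.val : {j // j ≠ v} → Y))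
  map : IsStrong H (D.map φ)

/-- The entries `(x, y)`, `(x₁, y)`, `(x₁, y₁)`, `(x', y₁)` form an induced path from row `x` to row
`x'` in the bipartite graph of nonzero entries of `D`. -/
structure IsInducedPath (D : Matrix X Y S) (x : X) (y : Y) (x₁ : X) (y₁ : Y) (x' : X) : Prop where
  first : D x y ≠ 0
  second : D x₁ y ≠ 0
  third : D x₁ y₁ ≠ 0
  fourth : D x' y₁ ≠ 0
  first_eq_zero : D x y₁ = 0
  last_eq_zero : D x' y = 0

namespace IsInducedPath

variable {D : Matrix X Y S} {x x₁ x' : X} {y y₁ : Y}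

theorem symm (p : IsInducedPath D x y x₁ y₁ x') : IsInducedPath D x' y₁ x₁ y x :=
  ⟨p.fourth, p.third, p.second, p.first, p.last_eq_zero, p.first_eq_zero⟩

theorem row_ne (p : IsInducedPath D x y x₁ y₁ x') : x ≠ x₁ := by
  rintro rfl
  exact p.third p.first_eq_zero

theorem col_ne (p : IsInducedPath D x y x₁ y₁ x') : y₁ ≠ y := by
  rintro rfl
  exact p.first p.first_eq_zero

theorem pivot_last [DecidableEq X] [DecidableEq Y] (p : IsInducedPath D x y x₁ y₁ x') (j : Y) :
    pivot D x₁ y x' j = D x' j :=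
  pivot_of_row_eq_zero D p.symm.row_ne p.last_eq_zero

theorem pivot_first_ne_zero [Nontrivial S] [DecidableEq X] [DecidableEq Y]
    (hD : ∀ i j, UnitOrZero K (D i j)) (p : IsInducedPath D x y x₁ y₁ x') :
    pivot D x₁ y x y₁ ≠ 0 :=
  pivot_ne_zero_of_eq_zero hD p.first_eq_zero p.second p.third p.first

end IsInducedPath

namespace IsGlued

variable {D : Matrix X Y S} {u v : Y}

theorem symm (h : IsGlued φ K H D u v) : IsGlued φ K H D v u :=
  ⟨h.ne.symm, h.right, h.left, h.map⟩

theorem apply (h : IsGlued φ K H D u v) (i : X) (j : Y) : UnitOrZero K (D i j) := by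
  by_cases hj : j = u
  · exact h.right.apply i ⟨j, hj ▸ h.ne⟩
  · exact h.left.apply i ⟨j, hj⟩

theorem ratio_left [Nontrivial S] (hK : -1 ∈ K) (h : IsGlued φ K H D u v) {x x' : X}
    {y y' : Y} (hy : y ≠ u) (hy' : y' ≠ u) (hxy : D x y ≠ 0) (hxy' : D x y' ≠ 0) (hx'y : D x' y ≠ 0)
    (hx'y' : D x' y' ≠ 0) : HasFundamentalRatio K D x x' y y' :=
  h.left.hasFundamentalRatio hK (y := (⟨y, hy⟩ : {j // j ≠ u})) (y' := ⟨y', hy'⟩) hxy hxy'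
    hx'y hx'y'

variable [Nontrivial R] {x x₁ x' : X} {y y₁ : Y}

theorem map_ne_zero (h : IsGlued φ K H D u v) {i : X} {j : Y} (hij : D i j ≠ 0) :
    D.map φ i j ≠ 0 :=
  fun h0 => hij ((h.apply i j).map_eq_zero.1 h0)

protected theorem pivot [DecidableEq X] [DecidableEq Y] (L : IsLifting φ K H)
    (h : IsGlued φ K H D u v) (hxy : D x y ≠ 0) (hu : y ≠ u) (hv : y ≠ v) :
    IsGlued φ K H (pivot D x y) u v := by
  refine ⟨h.ne, ?_, ?_, ?_⟩
  · have := h.left.pivot L.neg_one_mem_source (x := x) (y := ⟨y, hu⟩) hxy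
    rwa [pivot_submatrix _ Function.injective_id Subtype.val_injective] at this
  · have := h.right.pivot L.neg_one_mem_source (x := x) (y := ⟨y, hv⟩) hxy
    rwa [pivot_submatrix _ Function.injective_id Subtype.val_injective] at this
  · rw [pivot_map _ _ ((h.apply _ _).isUnit hxy)]
    exact h.map.pivot L.neg_one_mem_target (h.map_ne_zero hxy)

theorem ratio_map (hH : -1 ∈ H) (h : IsGlued φ K H D u v) (hx : D x u ≠ 0 ∧ D x v ≠ 0)
    (hx' : D x' u ≠ 0 ∧ D x' v ≠ 0) : HasFundamentalRatio H (D.map φ) x x' u v :=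
  h.map.hasFundamentalRatio hH (h.map_ne_zero hx.1) (h.map_ne_zero hx.2) (h.map_ne_zero hx'.1)
    (h.map_ne_zero hx'.2)

variable [Nontrivial S] (L : IsLifting φ K H) (h : IsGlued φ K H D u v) (hx : D x u ≠ 0 ∧ D x v ≠ 0)
  (hx' : D x' u ≠ 0 ∧ D x' v ≠ 0)

include L h hx hx'

theorem ratio_of_mul {f g : S} (hf : IsFundamental K f) (hg : IsFundamental K g)
    (hfg : f * g * (D x v * D x' u) = D x u * D x' v) : HasFundamentalRatio K D x x' u v := by
  refine ⟨f * g, L.isFundamental_mul hf hg ?_, hfg⟩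
  obtain ⟨e, he, heq⟩ := h.ratio_map L.neg_one_mem_target hx hx'
  have hne := ((h.apply x v).mul (h.apply x' u)).isUnit ((h.apply _ _).mul_ne_zero hx.2 hx'.1)
  convert he
  refine (hne.map φ).mul_left_inj.1 ?_
  rw [← map_mul, hfg]
  simpa using heq.symm

theorem ratio_trans (hx₁ : D x₁ u ≠ 0 ∧ D x₁ v ≠ 0) (h₁ : HasFundamentalRatio K D x x₁ u v)
    (h₂ : HasFundamentalRatio K D x₁ x' u v) : HasFundamentalRatio K D x x' u v := by
  obtain ⟨f, hf, hfeq⟩ := h₁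
  obtain ⟨g, hg, hgeq⟩ := h₂
  refine h.ratio_of_mul L hx hx' hf hg ?_
  refine (((h.apply _ _).mul (h.apply _ _)).isUnit
    ((h.apply _ _).mul_ne_zero hx₁.1 hx₁.2)).mul_left_inj.1 ?_
  linear_combination g * D x₁ v * D x' u * hfeq + D x u * D x₁ v * hgeq

theorem ratio_of_common_col (hu : y ≠ u) (hv : y ≠ v) (hxy : D x y ≠ 0) (hx'y : D x' y ≠ 0) :
    HasFundamentalRatio K D x x' u v := by
  obtain ⟨f, hf, hfeq⟩ := h.symm.ratio_left L.neg_one_mem_source h.ne hv hx.1 hxy hx'.1 hx'y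
  obtain ⟨g, hg, hgeq⟩ := h.ratio_left L.neg_one_mem_source hu h.ne.symm hxy hx.2 hx'y hx'.2
  refine h.ratio_of_mul L hx hx' hf hg ?_
  refine (((h.apply _ _).mul (h.apply _ _)).isUnit
    ((h.apply _ _).mul_ne_zero hxy hx'y)).mul_left_inj.1 ?_
  linear_combination g * D x v * D x' y * hfeq + D x u * D x' y * hgeq

variable (p : IsInducedPath D x y x₁ y₁ x') (hy : y ≠ u ∧ y ≠ v) (hy₁ : y₁ ≠ u ∧ y₁ ≠ v)

include p hy hy₁

theorem ratio_of_path_of_eq_zero (hu : D x₁ u = 0) (hv : D x₁ v = 0) :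
    HasFundamentalRatio K D x x' u v := by
  classical
  have hPu : ∀ i, pivot D x₁ y i u = D i u := fun i => pivot_of_col_eq_zero _ hy.1.symm hu
  have hPv : ∀ i, pivot D x₁ y i v = D i v := fun i => pivot_of_col_eq_zero _ hy.2.symm hv
  simpa only [HasFundamentalRatio, hPu, hPv] using
    (h.pivot L p.second hy.1 hy.2).ratio_of_common_col L (x := x) (x' := x') (y := y₁)
      (by rwa [hPu, hPv]) (by rwa [hPu, hPv]) hy₁.1 hy₁.2 (p.pivot_first_ne_zero h.apply)
      (by rw [p.pivot_last]; exact p.fourth)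

theorem ratio_of_path_of_ne_one (hx₁v : D x₁ v = 0) {a : S} (ha : IsFundamental K a) (ha1 : a ≠ 1)
    (haeq : a * (D x u * D x₁ y) = D x y * D x₁ u) : HasFundamentalRatio K D x x' u v := by
  classical
  have hpu : pivot D x₁ y x u = D x u * (1 - a) := by
    rw [pivot_of_ne _ p.row_ne hy.1.symm]
    linear_combination Ring.inverse (D x₁ y) * haeq -
      D x u * a * (h.apply _ _).mul_inverse p.second
  have hpv : pivot D x₁ y x v = D x v := pivot_of_col_eq_zero _ hy.2.symm hx₁v
  have ha' := ha.one_sub_of_ne_one ha1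
  obtain ⟨f, hf, hfeq⟩ := (h.pivot L p.second hy.1 hy.2).ratio_of_common_col L (x := x) (x' := x')
    ⟨by rw [hpu]; exact (h.apply _ _).mul_ne_zero hx.1 ha'.ne_zero, by rw [hpv]; exact hx.2⟩
    (by rwa [p.pivot_last, p.pivot_last]) hy₁.1 hy₁.2 (p.pivot_first_ne_zero h.apply)
    (by rw [p.pivot_last]; exact p.fourth)
  rw [hpu, hpv, p.pivot_last, p.pivot_last] at hfeq
  refine h.ratio_of_mul L hx hx' hf (ha'.inverse L.neg_one_mem_source) ?_
  linear_combination Ring.inverse (1 - a) * hfeq + D x u * D x' v * ha'.mul_inverse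

/- The cross ratio `g` of the pivot in the columns `y₁` and `v` is minus the one of `D` in the
columns `u` and `v`, and the latter is fundamental because its image is. -/
theorem ratio_of_path_of_eq_one (hx₁v : D x₁ v = 0) (ha : D x u * D x₁ y = D x y * D x₁ u)
    (hb : D x' u * D x₁ y₁ = D x' y₁ * D x₁ u) (hx₁u : D x₁ u ≠ 0) :
    HasFundamentalRatio K D x x' u v := by
  classical
  have hpv : pivot D x₁ y x v = D x v := pivot_of_col_eq_zero _ hy.2.symm hx₁v
  obtain ⟨g, hg, hgeq⟩ := (h.pivot L p.second hy.1 hy.2).ratio_left L.neg_one_mem_source hy₁.1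
    h.ne.symm (x := x) (x' := x') (p.pivot_first_ne_zero h.apply) (by rw [hpv]; exact hx.2)
    (by rw [p.pivot_last]; exact p.fourth) (by rw [p.pivot_last]; exact hx'.2)
  rw [pivot_of_ne _ p.row_ne p.col_ne, p.first_eq_zero, hpv, p.pivot_last, p.pivot_last] at hgeq
  have hgneg : -g * (D x v * D x' u) = D x u * D x' v := by
    refine (((h.apply _ _).mul (h.apply _ _)).isUnit
      ((h.apply _ _).mul_ne_zero p.fourth hx₁u)).mul_left_inj.1 ?_
    linear_combination (-D x' u * D x₁ u) * hgeq +
      D x₁ u * D x y * Ring.inverse (D x₁ y) * D x' v * hb -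
      Ring.inverse (D x₁ y) * D x' v * D x' y₁ * D x₁ u * ha +
      D x u * D x' v * D x' y₁ * D x₁ u * (h.apply _ _).mul_inverse p.second
  obtain ⟨e, he, heeq⟩ := h.ratio_map L.neg_one_mem_target hx hx'
  obtain ⟨f, hf, rfl⟩ := L.exists_fundamental e he
  have hne := ((h.apply x v).mul (h.apply x' u)).isUnit ((h.apply _ _).mul_ne_zero hx.2 hx'.1)
  have hfg : φ f = -φ g := by
    refine (hne.map φ).mul_left_inj.1 ?_
    rw [← map_neg, ← map_mul φ (-g), hgneg]
    simpa using heeq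
  exact ⟨f, hf, by rw [L.eq_neg f g hf hg hfg, hgneg]⟩

theorem ratio_of_path_of_ne_zero (hx₁u : D x₁ u ≠ 0) (hx₁v : D x₁ v = 0) :
    HasFundamentalRatio K D x x' u v := by
  have hK := L.neg_one_mem_source
  obtain ⟨a, ha, haeq⟩ := h.symm.ratio_left hK hy.2 h.ne p.first hx.1 p.second hx₁u
  obtain ⟨b, hb, hbeq⟩ := h.symm.ratio_left hK hy₁.2 h.ne p.fourth hx'.1 p.third hx₁u
  by_cases ha1 : a = 1
  swap
  · exact h.ratio_of_path_of_ne_one L hx hx' p hy hy₁ hx₁v ha ha1 haeq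
  by_cases hb1 : b = 1
  swap
  · exact (h.ratio_of_path_of_ne_one L hx' hx p.symm hy₁ hy hx₁v hb hb1 hbeq).swap_rows hK
  subst ha1 hb1
  rw [one_mul] at haeq hbeq
  exact h.ratio_of_path_of_eq_one L hx hx' p hy hy₁ hx₁v haeq hbeq hx₁u

theorem ratio_of_path : HasFundamentalRatio K D x x' u v := by
  by_cases hu : D x₁ u = 0 <;> by_cases hv : D x₁ v = 0
  · exact h.ratio_of_path_of_eq_zero L hx hx' p hy hy₁ hu hv
  · exact (h.symm.ratio_of_path_of_ne_zero L hx.symm hx'.symm p hy.symm hy₁.symm hv hu).swap_cols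
      L.neg_one_mem_source
  · exact h.ratio_of_path_of_ne_zero L hx hx' p hy hy₁ hu hv
  · exact h.ratio_trans L hx hx' ⟨hu, hv⟩
      (h.ratio_of_common_col L hx ⟨hu, hv⟩ hy.1 hy.2 p.first p.second)
      (h.ratio_of_common_col L ⟨hu, hv⟩ hx' hy₁.1 hy₁.2 p.third p.fourth)

omit h hx hx' p hy hy₁ in
theorem ratio_of_chain {n : ℕ} {D : Matrix X Y S} (h : IsGlued φ K H D u v) {x x' : X}
    (hc : Chain D {j | j ≠ u ∧ j ≠ v} n x x') (hx : D x u ≠ 0 ∧ D x v ≠ 0)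
    (hx' : D x' u ≠ 0 ∧ D x' v ≠ 0) : HasFundamentalRatio K D x x' u v := by
  classical
  induction n using Nat.strong_induction_on generalizing D with
  | _ n ih =>
  match n, hc with
  | 0, .nil _ => exact .refl _ _ _ _
  | 1, .cons hy hxy hx'y (.nil _) => exact h.ratio_of_common_col L hx hx' hy.1 hy.2 hxy hx'y
  | 2, .cons (x₁ := x₁) (y := y) hy hxy hx₁y (.cons (y := y₁) hy₁ hx₁y₁ hx'y₁ (.nil _)) =>
    by_cases hxy₁ : D x y₁ = 0
    swap
    · exact h.ratio_of_common_col L hx hx' hy₁.1 hy₁.2 hxy₁ hx'y₁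
    by_cases hx'y : D x' y = 0
    swap
    · exact h.ratio_of_common_col L hx hx' hy.1 hy.2 hxy hx'y
    exact h.ratio_of_path L hx hx' ⟨hxy, hx₁y, hx₁y₁, hx'y₁, hxy₁, hx'y⟩ hy hy₁
  | n + 3, hc =>
    obtain ⟨m, hm, hc⟩ | ⟨p, q, hq, hpq, hxq, hx'q, hc⟩ := hc.exists_shorter_or_pivot h.apply
    · exact ih m (by omega) h hc hx hx'
    have hPx : ∀ j, pivot D p q x j = D x j := fun j =>
      pivot_of_row_eq_zero _ (by rintro rfl; exact hpq hxq) hxq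
    have hPx' : ∀ j, pivot D p q x' j = D x' j := fun j =>
      pivot_of_row_eq_zero _ (by rintro rfl; exact hpq hx'q) hx'q
    simpa only [HasFundamentalRatio, hPx, hPx'] using
      ih (n + 2) (by omega) (h.pivot L hpq hq.1 hq.2) hc (by rwa [hPx, hPx]) (by rwa [hPx', hPx'])

end IsGlued

end Glued

section Uniqueness

variable {S R : Type*} [CommRing S] [CommRing R] {φ : S →+* R} {K : Subgroup Sˣ} {H : Subgroup Rˣ}

variable (φ K) in
/-- The units in `K` that `φ` maps to `1`: scaling by them does not change the image of a matrix. -/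
def kerSubgroup : Subgroup Sˣ := K ⊓ (Units.map (φ : S →* R)).ker

theorem kerSubgroup_map (a : kerSubgroup φ K) : φ (a : Sˣ) = 1 :=
  congrArg Units.val (MonoidHom.mem_ker.1 a.2.2)

theorem kerSubgroup_unitOrZero (a : kerSubgroup φ K) : UnitOrZero K ((a : Sˣ) : S) :=
  .of_mem a.2.1

theorem exists_kerSubgroup_mul_eq [Nontrivial R] {a b : S} (ha : UnitOrZero K a)
    (hb : UnitOrZero K b) (hab : φ a = φ b) : ∃ t : kerSubgroup φ K, b = (t : Sˣ) * a := by
  obtain rfl | ⟨s, hs, rfl⟩ := ha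
  · exact ⟨1, by rw [mul_zero]; exact hb.map_eq_zero.1 (by rw [← hab, map_zero])⟩
  obtain rfl | ⟨t, ht, rfl⟩ := hb
  · exact absurd hab (by rw [map_zero]; exact (s.isUnit.map φ).ne_zero)
  refine ⟨⟨t * s⁻¹, K.mul_mem ht (K.inv_mem hs), MonoidHom.mem_ker.2 ?_⟩, by simp⟩
  rw [map_mul, map_inv, mul_inv_eq_one]
  exact Units.ext hab.symm

variable {X : Type*} {Y : Type w} {D E : Matrix X Y S} {u : Y}

/-- The partition of the rows of `D` by the chains in the columns `T`. -/
def chainSetoid (D : Matrix X Y S) (T : Set Y) : Setoid X where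
  r x x' := ∃ n, Chain D T n x x'
  iseqv := ⟨fun x => ⟨0, .nil x⟩, fun ⟨n, h⟩ => ⟨n, h.symm⟩,
    fun ⟨m, h⟩ ⟨n, h'⟩ => ⟨m + n, h.trans h'⟩⟩

variable [Nontrivial S] [Nontrivial R]

/- Both copies of column `u` together with the common columns form a glued matrix, and the cross
ratio of the two copies is a fundamental element that `φ` maps to `1`. -/
theorem IsLifting.mul_eq_mul_of_chain (L : IsLifting φ K H) (hD : IsStrong K D) (hE : IsStrong K E)
    (hDE : D.map φ = E.map φ) (hφ : IsStrong H (D.map φ)) (hT : ∀ i, ∀ j ≠ u, D i j = E i j)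
    {n : ℕ} {x x' : X} (hc : Chain D {j | j ≠ u} n x x') (hx : D x u ≠ 0) (hx' : D x' u ≠ 0) :
    E x u * D x' u = D x u * E x' u := by
  classical
  have hDE' : ∀ i j, φ (E i j) = φ (D i j) := fun i j => congrFun (congrFun hDE.symm i) j
  have hne : ∀ i, D i u ≠ 0 → E i u ≠ 0 := fun i h => by
    rwa [Ne, ← (hE.apply i u).map_eq_zero (φ := φ), hDE', (hD.apply i u).map_eq_zero]
  let G : Matrix X (Option Y) S := of fun i j => j.elim (E i u) (D i)
  have hG : IsGlued φ K H G none (some u) := by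
    refine ⟨nofun, ?_, ?_, ?_⟩
    · convert hD.submatrix id (fun j : {j : Option Y // j ≠ none} => j.1.getD u) using 1
      ext i ⟨_ | j, hj⟩
      exacts [absurd rfl hj, rfl]
    · convert hE.submatrix id (fun j : {j : Option Y // j ≠ some u} => j.1.getD u) using 1
      ext i ⟨_ | j, hj⟩
      exacts [rfl, hT i j fun h => hj (congrArg some h)]
    · convert hφ.submatrix id (fun j : Option Y => j.getD u) using 1
      ext i (_ | j)
      exacts [hDE' i u, rfl]
  obtain ⟨f, hf, hfeq⟩ := hG.ratio_of_chain L
    (hc.map_columns (D' := G) (g := some) (fun j hj => ⟨nofun, by simpa using hj⟩) fun _ _ _ => rfl)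
    ⟨hne x hx, hx⟩ ⟨hne x' hx', hx'⟩
  change f * (D x u * E x' u) = E x u * D x' u at hfeq
  rw [← hfeq, L.injOn hf .one ?_, one_mul]
  refine (((hD.apply x u).mul (hE.apply x' u)).isUnit
    ((hD.apply x u).mul_ne_zero hx (hne x' hx')) |>.map φ).mul_left_inj.1 ?_
  rw [← map_mul, hfeq]
  simp only [map_mul, map_one, hDE', one_mul]

theorem IsLifting.exists_row_factor (L : IsLifting φ K H) (hD : IsStrong K D)
    (hE : IsStrong K E) (hDE : D.map φ = E.map φ) (hφ : IsStrong H (D.map φ))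
    (hT : ∀ i, ∀ j ≠ u, D i j = E i j) :
    ∃ ρ : Quotient (chainSetoid D {j | j ≠ u}) → kerSubgroup φ K,
      ∀ x, E x u = ((ρ ⟦x⟧ : Sˣ) : S) * D x u := by
  choose t ht using fun x => exists_kerSubgroup_mul_eq (hD.apply x u) (hE.apply x u)
    (congrFun (congrFun hDE x) u)
  have hts : Function.FactorsThrough (fun x : {x // D x u ≠ 0} => t x)
      (fun x => (⟦x.1⟧ : Quotient (chainSetoid D {j | j ≠ u}))) := by
    rintro ⟨x, hx⟩ ⟨x', hx'⟩ h
    obtain ⟨n, hn⟩ := Quotient.exact h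
    have := L.mul_eq_mul_of_chain hD hE hDE hφ hT hn hx hx'
    rw [ht x, ht x'] at this
    refine Subtype.ext (Units.ext ((((hD.apply x u).mul (hD.apply x' u)).isUnit
      ((hD.apply x u).mul_ne_zero hx hx')).mul_left_inj.1 ?_))
    linear_combination this
  obtain ⟨ρ, hρ⟩ := (Function.factorsThrough_iff _).1 hts
  refine ⟨ρ, fun x => ?_⟩
  obtain h0 | h0 := eq_or_ne (D x u) 0
  · rw [ht x, h0, mul_zero, mul_zero]
  · rw [ht x, show t x = ρ ⟦x⟧ from congrFun hρ ⟨x, h0⟩]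

theorem IsLifting.exists_scaling_of_forall_ne (L : IsLifting φ K H) (hD : IsStrong K D)
    (hE : IsStrong K E) (hDE : D.map φ = E.map φ) (hφ : IsStrong H (D.map φ))
    (hT : ∀ i, ∀ j ≠ u, D i j = E i j) :
    ∃ (r : X → kerSubgroup φ K) (c : Y → kerSubgroup φ K),
      ∀ x y, E x y = ((r x : Sˣ) : S) * ((c y : Sˣ) : S) * D x y := by
  classical
  obtain ⟨ρ, hρ⟩ := L.exists_row_factor hD hE hDE hφ hT
  have hγ : Function.FactorsThrough
      (fun p : {p : X × Y // D p.1 p.2 ≠ 0 ∧ p.2 ≠ u} => (ρ ⟦p.1.1⟧)⁻¹) (fun p => p.1.2) := by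
    rintro ⟨⟨x, y⟩, h, hy⟩ ⟨⟨x', y'⟩, h', hy'⟩ (rfl : y = y')
    exact congrArg (fun a => (ρ a)⁻¹) (Quotient.sound ⟨1, .cons hy h h' (.nil _)⟩)
  obtain ⟨γ, hγ⟩ := (Function.factorsThrough_iff _).1 hγ
  refine ⟨fun x => ρ ⟦x⟧, fun y => if y = u then 1 else γ y, fun x y => ?_⟩
  dsimp only
  obtain rfl | hy := eq_or_ne y u
  · simp only [if_pos, Subgroup.coe_one, Units.val_one, mul_one, hρ x]
  obtain h0 | h0 := eq_or_ne (D x y) 0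
  · rw [← hT x y hy, h0, mul_zero]
  · rw [if_neg hy, ← show (ρ ⟦x⟧)⁻¹ = γ y from congrFun hγ ⟨(x, y), h0, hy⟩, ← hT x y hy]
    simp

theorem IsLifting.exists_scaling [Finite Y] (L : IsLifting φ K H) (hD : IsStrong K D)
    (hE : IsStrong K E) (hDE : D.map φ = E.map φ) (hφ : IsStrong H (D.map φ)) :
    ∃ (r : X → kerSubgroup φ K) (c : Y → kerSubgroup φ K),
      ∀ x y, E x y = ((r x : Sˣ) : S) * ((c y : Sˣ) : S) * D x y := by
  induction Y using Finite.induction_empty_option with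
  | of_equiv e ih =>
    obtain ⟨r, c, h⟩ := ih (hD.submatrix id e) (hE.submatrix id e)
      (congrArg (submatrix · id e) hDE) (hφ.submatrix id e)
    exact ⟨r, c ∘ e.symm, fun x y => by simpa using h x (e.symm y)⟩
  | h_empty => exact ⟨1, 1, fun _ y => y.elim⟩
  | @h_option Y _ ih =>
    obtain ⟨r, c, h⟩ := ih (hD.submatrix id some) (hE.submatrix id some)
      (congrArg (submatrix · id some) hDE) (hφ.submatrix id some)
    let F : Matrix X (Option Y) S :=
      of fun x y => ((r x : Sˣ) : S) * ((y.elim 1 c : kerSubgroup φ K) : Sˣ) * D x y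
    have hF : IsStrong K F := hD.scale (fun x => kerSubgroup_unitOrZero (r x))
      fun y => kerSubgroup_unitOrZero (y.elim 1 c)
    have hDF : D.map φ = F.map φ := by
      ext x y
      simp [F, kerSubgroup_map]
    obtain ⟨r', c', h'⟩ := L.exists_scaling_of_forall_ne (u := none) hF hE (hDF ▸ hDE) (hDF ▸ hφ)
      fun x y hy => by
        obtain ⟨y, rfl⟩ := Option.ne_none_iff_exists'.1 hy
        exact (h x y).symm
    refine ⟨r' * r, fun y => c' y * y.elim 1 c, fun x y => ?_⟩
    rw [h' x y]
    simp only [F, of_apply, Pi.mul_apply, Subgroup.coe_mul, Units.val_mul]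
    ring

end Uniqueness

section RowConnected

variable {R : Type*} [CommRing R] {X Y : Type*} {D : Matrix X Y R} {T : Set Y}

/-- A set of rows and a set of columns, given by their membership predicates `s` and `t`, such that
no nonzero entry of `D` in the columns `T` lies in exactly one of them. -/
def IsSeparation (D : Matrix X Y R) (T : Set Y) (s : X → Prop) (t : Y → Prop) : Prop :=
  ∀ x, ∀ y ∈ T, D x y ≠ 0 → (s x ↔ t y)

theorem IsSeparation.of_pivot [DecidableEq X] [DecidableEq Y] [Nontrivial R] {H : Subgroup Rˣ}
    (hD : ∀ i j, UnitOrZero H (D i j)) {x : X} {y : Y} (hy : y ∈ T) (hxy : D x y ≠ 0)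
    {s : X → Prop} {t : Y → Prop} (hst : IsSeparation (pivot D x y) T s t) :
    IsSeparation D T s t := by
  have hinv := (hD _ _).inverse_ne_zero hxy
  have hcol : ∀ i, D i y ≠ 0 → (s i ↔ t y) := by
    refine fun i hi => hst i y hy ?_
    obtain rfl | hix := eq_or_ne i x
    · rwa [pivot_self]
    · rw [pivot_col _ hix, neg_ne_zero]
      exact (hD _ _).mul_ne_zero hi hinv
  have hrow : ∀ j ∈ T, D x j ≠ 0 → (s x ↔ t j) := by
    intro j hj hxj
    obtain rfl | hjy := eq_or_ne j y
    · exact hcol x hxy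
    · exact hst x j hj (by rw [pivot_row _ hjy]; exact (hD _ _).inverse.mul_ne_zero hinv hxj)
  intro i j hj hij
  obtain h0 | h0 := eq_or_ne (D i y) 0
  · obtain rfl | hix := eq_or_ne i x
    · exact hrow j hj hij
    · exact hst i j hj (by rwa [pivot_of_row_eq_zero _ hix h0])
  obtain h1 | h1 := eq_or_ne (D x j) 0
  · obtain rfl | hjy := eq_or_ne j y
    · exact hcol i hij
    · exact hst i j hj (by rwa [pivot_of_col_eq_zero _ hjy h1])
  rw [hcol i h0, ← hcol x hxy, hrow j hj h1]

/-- Any two rows of `D` are joined in the bipartite graph of nonzero entries in the columns `T`,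
stated by the absence of separations because these are easily followed through pivots. -/
def RowConnected (D : Matrix X Y R) (T : Set Y) : Prop :=
  ∀ (s : X → Prop) (t : Y → Prop), IsSeparation D T s t → ∀ x x', s x ↔ s x'

namespace RowConnected

theorem exists_chain (h : RowConnected D T) (x x' : X) : ∃ n, Chain D T n x x' := by
  refine (h (fun i => ∃ n, Chain D T n i x') (fun j => ∃ i, D i j ≠ 0 ∧ ∃ n, Chain D T n i x')
    (fun i j hj hij => ⟨fun hi => ⟨i, hij, hi⟩, ?_⟩) x x').2 ⟨0, .nil _⟩
  rintro ⟨i', hi', n, hn⟩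
  exact ⟨n + 1, .cons hj hij hi' hn⟩

protected theorem pivot [DecidableEq X] [DecidableEq Y] [Nontrivial R] {H : Subgroup Rˣ}
    (h : RowConnected D T) (hD : ∀ i j, UnitOrZero H (D i j)) {x : X} {y : Y} (hy : y ∈ T)
    (hxy : D x y ≠ 0) : RowConnected (pivot D x y) T :=
  fun s t hst => h s t (hst.of_pivot hD hy hxy)

end RowConnected

end RowConnected

section Gluing

variable {S R : Type*} [CommRing S] [CommRing R] {φ : S →+* R} {K : Subgroup Sˣ} {H : Subgroup Rˣ}
  {X Y : Type*}

namespace IsGlued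

variable [Nontrivial S] [Nontrivial R] {u v : Y} {D : Matrix X Y S}

theorem det_two (L : IsLifting φ K H) (h : IsGlued φ K H D u v)
    (hc : RowConnected D {j | j ≠ u ∧ j ≠ v}) (x x' : X) :
    UnitOrZero K (D x u * D x' v - D x v * D x' u) := by
  by_cases h0 : D x u * D x' v = 0 ∨ D x v * D x' u = 0
  · exact .sub_of_eq_zero L.neg_one_mem_source ((h.apply _ _).mul (h.apply _ _))
      ((h.apply _ _).mul (h.apply _ _)) h0
  obtain ⟨h1, h2⟩ := not_or.1 h0
  obtain ⟨n, hn⟩ := hc.exists_chain x x'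
  exact (h.ratio_of_chain L hn ⟨left_ne_zero_of_mul h1, left_ne_zero_of_mul h2⟩
    ⟨right_ne_zero_of_mul h2, right_ne_zero_of_mul h1⟩).det L.neg_one_mem_source h.apply

theorem det_submatrix_pair (L : IsLifting φ K H) (h : IsGlued φ K H D u v)
    (hc : RowConnected D {j | j ≠ u ∧ j ≠ v}) {k : ℕ} (f : Fin k → X) {g : Fin k → Y}
    (hg : g.Injective) (huv : ∀ j, g j = u ∨ g j = v) : UnitOrZero K (D.submatrix f g).det := by
  classical
  have hk : k ≤ 2 := by
    simpa using (Finset.card_le_card_of_injOn g (s := Finset.univ) (t := {u, v})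
      (fun j _ => by simpa using huv j) hg.injOn).trans Finset.card_le_two
  interval_cases k
  · simpa using UnitOrZero.one
  · simpa using h.apply (f 0) (g 0)
  · rw [det_fin_two]
    have hne : g 0 ≠ g 1 := hg.ne (by decide)
    obtain h0 | h0 := huv 0 <;> obtain h1 | h1 := huv 1
    · exact absurd (h0.trans h1.symm) hne
    · simpa only [submatrix_apply, h0, h1] using h.det_two L hc _ _
    · simpa only [submatrix_apply, h0, h1] using
        (h.det_two L hc _ _).sub_comm L.neg_one_mem_source
    · exact absurd (h0.trans h1.symm) hne

theorem isStrong (L : IsLifting φ K H) (h : IsGlued φ K H D u v)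
    (hc : RowConnected D {j | j ≠ u ∧ j ≠ v}) : IsStrong K D := by
  classical
  intro k
  induction k generalizing D with
  | zero => intro f g; simpa using UnitOrZero.one
  | succ k ih =>
    intro f g
    refine unitOrZero_det_of_injective D f g fun hf hg => ?_
    by_cases! hj : ∃ j, g j ≠ u ∧ g j ≠ v
    · obtain ⟨j, hj⟩ := hj
      by_cases! h0 : ∀ i, D (f i) (g j) = 0
      · rw [det_eq_zero_of_column_eq_zero j h0]
        exact .zero
      obtain ⟨i, hi⟩ := h0
      rw [det_submatrix_eq_det_pivot D hf hg i j ((h.apply _ _).isUnit hi)]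
      exact ((UnitOrZero.neg_one_pow L.neg_one_mem_source _).mul (h.apply _ _)).mul
        (ih (h.pivot L hi hj.1 hj.2) (hc.pivot h.apply hj hi) _ _)
    · exact h.det_submatrix_pair L hc f hg fun j => or_iff_not_imp_left.2 (hj j)

end IsGlued

variable (φ K) in
/-- The matrix `D` is the image under `φ` of a strong matrix over `(S, K)`. -/
def HasStrongLift (D : Matrix X Y R) : Prop := ∃ E : Matrix X Y S, IsStrong K E ∧ E.map φ = D

/- The two lifts differ by a scaling on the common columns, so that they can be made to agree
there. -/
theorem exists_isGlued [Nontrivial S] [Nontrivial R] [Finite Y] (L : IsLifting φ K H)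
    {D : Matrix X Y R} (hD : IsStrong H D) {u v : Y} (huv : u ≠ v)
    (hu : HasStrongLift φ K (D.submatrix id (Subtype.val : {j // j ≠ u} → Y)))
    (hv : HasStrongLift φ K (D.submatrix id (Subtype.val : {j // j ≠ v} → Y))) :
    ∃ E : Matrix X Y S, IsGlued φ K H E u v ∧ E.map φ = D := by
  classical
  obtain ⟨A, hA, hAD⟩ := hu
  obtain ⟨B, hB, hBD⟩ := hv
  have hA' : ∀ x j, φ (A x j) = D x j := fun x j => congrFun (congrFun hAD x) j
  have hB' : ∀ x j, φ (B x j) = D x j := fun x j => congrFun (congrFun hBD x) j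
  obtain ⟨r, c, hrc⟩ := L.exists_scaling
    (hA.submatrix id fun j : {j // j ≠ u ∧ j ≠ v} => (⟨j, j.2.1⟩ : {j // j ≠ u}))
    (hB.submatrix id fun j : {j // j ≠ u ∧ j ≠ v} => (⟨j, j.2.2⟩ : {j // j ≠ v}))
    (by ext x j; simp [hA', hB'])
    (by convert hD.submatrix id (fun j : {j // j ≠ u ∧ j ≠ v} => j.1); ext x j; simp [hA'])
  let E : Matrix X Y S := of fun x j =>
    if h : j = v then ((r x : Sˣ) : S) * A x ⟨v, huv.symm⟩ else B x ⟨j, h⟩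
  have hED : E.map φ = D := by
    ext x j
    by_cases h : j = v
    · subst h
      simp [E, hA', kerSubgroup_map]
    · simp [E, h, hB']
  refine ⟨E, ⟨huv, ?_, ?_, hED ▸ hD⟩, hED⟩
  · convert hA.scale (r := fun x => ((r x : Sˣ) : S))
      (c := fun j => if h : j.1 = v then 1 else ((c ⟨j, j.2, h⟩ : Sˣ) : S))
      (fun x => kerSubgroup_unitOrZero _) fun j => ?_
    · ext x ⟨j, hj⟩
      by_cases h : j = v
      · subst h; simp [E]
      · simpa [E, h] using hrc x ⟨j, hj, h⟩
    · split_ifs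
      exacts [.one, kerSubgroup_unitOrZero _]
  · convert hB
    ext x ⟨j, hj⟩
    simp [E, hj]

theorem hasStrongLift_of_columns [Nontrivial S] [Nontrivial R] [Finite Y] (L : IsLifting φ K H)
    {D : Matrix X Y R} (hD : IsStrong H D) {u v : Y} (huv : u ≠ v)
    (hc : RowConnected D {j | j ≠ u ∧ j ≠ v})
    (hu : HasStrongLift φ K (D.submatrix id (Subtype.val : {j // j ≠ u} → Y)))
    (hv : HasStrongLift φ K (D.submatrix id (Subtype.val : {j // j ≠ v} → Y))) :
    HasStrongLift φ K D := by
  classical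
  obtain ⟨E, hE, rfl⟩ := exists_isGlued L hD huv hu hv
  exact ⟨E, hE.isStrong L fun s t hst => hc s t fun x y hy hxy =>
    hst x y hy fun h0 => hxy (by rw [map_apply, h0, map_zero]), rfl⟩

end Gluing

section Graph

variable {V : Type*}

open Finset in
theorem two_lt_card_leaves_of_isTree [Fintype V] {G : SimpleGraph V} [DecidableRel G.Adj]
    (hG : G.IsTree) {z : V} (hz : 2 < G.degree z) : 2 < #{v | G.degree v = 1} := by
  obtain ⟨y, hy⟩ := (G.degree_pos_iff_exists_adj z).1 (by omega)
  have : Nontrivial V := ⟨z, y, hy.ne⟩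
  have hpos v : 0 < G.degree v := hG.1.preconnected.degree_pos_of_nontrivial v
  have hsum : ∑ v, ((G.degree v : ℤ) - 2) = -2 := by
    have h1 := G.sum_degrees_eq_twice_card_edges
    have h2 := hG.card_edgeFinset
    zify at h1 h2
    rw [sum_sub_distrib, h1, sum_const, card_univ, nsmul_eq_mul]
    linarith
  have hle : (1 : ℤ) ≤ ∑ v, ((G.degree v : ℤ) - 2 + if G.degree v = 1 then 1 else 0) := by
    refine le_trans ?_ (single_le_sum (fun v _ => ?_) (mem_univ z))
    · rw [if_neg (by omega)]
      omega
    · have := hpos v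
      split_ifs <;> omega
  rw [sum_add_distrib, hsum, sum_boole] at hle
  omega

/- Take two leaves of a spanning tree that contains all edges at the vertex of degree at least `3`,
and hence has at least three leaves. -/
theorem exists_ne_preconnected_induce_compl [Finite V] {G : SimpleGraph V} (hG : G.Connected)
    {z : V} (hz : 2 < (G.neighborSet z).ncard) (side : V → Bool) :
    ∃ u v, u ≠ v ∧ side u = side v ∧ (G.induce {u, v}ᶜ).Preconnected := by
  classical
  have := Fintype.ofFinite V
  obtain ⟨T, hzT, hTG, hT⟩ := hG.exists_isTree_le_of_le_of_isAcyclic inf_le_right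
    ((SimpleGraph.isAcyclic_starGraph z).anti (inf_le_left (b := G)))
  have hzT : 2 < T.degree z := by
    refine hz.trans_le ?_
    rw [← T.card_neighborSet_eq_degree, ← Nat.card_eq_fintype_card, Nat.card_coe_set_eq]
    exact Set.ncard_le_ncard fun y (hy : G.Adj z y) =>
      hzT ⟨SimpleGraph.starGraph_center_adj hy.ne, hy⟩
  obtain ⟨u, hu, v, hv, huv, hside⟩ := Finset.exists_ne_map_eq_of_card_lt_of_maps_to
    (f := side) (s := {w | T.degree w = 1}) (t := Finset.univ)
    (by simpa only [Finset.card_univ, Fintype.card_bool] using two_lt_card_leaves_of_isTree hT hzT)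
    fun _ _ => Finset.mem_coe.2 (Finset.mem_univ _)
  refine ⟨u, v, huv, hside, (hT.1.preconnected.induce_of_degree_eq_one fun w hw => ?_).mono
    (SimpleGraph.comap_monotone _ hTG)⟩
  have hw1 : T.degree w = 1 := by
    obtain rfl | rfl := not_not.1 hw
    exacts [(Finset.mem_filter.1 hu).2, (Finset.mem_filter.1 hv).2]
  rw [← T.card_neighborSet_eq_degree] at hw1
  exact Set.subsingleton_coe _ |>.1 (Fintype.card_le_one_iff_subsingleton.1 hw1.le)

end Graph

section Connected

variable {R : Type*} [CommRing R] {X Y : Type*} {D : Matrix X Y R}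

/-- The bipartite graph on the rows and columns of `D` whose edges are the nonzero entries. -/
def nonzeroGraph (D : Matrix X Y R) : SimpleGraph (X ⊕ Y) where
  Adj
    | .inl x, .inr y => D x y ≠ 0
    | .inr y, .inl x => D x y ≠ 0
    | _, _ => False
  symm := ⟨by rintro (_ | _) (_ | _) h <;> exact h⟩
  loopless := ⟨by rintro (_ | _) h <;> exact h⟩

/-- The bipartite graph of the nonzero entries of `D` is connected or empty, stated by the absence
of separations because these are easily followed through pivots. -/
def IsConnected (D : Matrix X Y R) : Prop :=
  ∀ (s : X → Prop) (t : Y → Prop), IsSeparation D Set.univ s t →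
    ((∀ x, s x) ∧ ∀ y, t y) ∨ ((∀ x, ¬s x) ∧ ∀ y, ¬t y)

/-- Some row or column of `D` has at least three nonzero entries. -/
def HasTriple (D : Matrix X Y R) : Prop :=
  (∃ x, 2 < {y | D x y ≠ 0}.ncard) ∨ ∃ y, 2 < {x | D x y ≠ 0}.ncard

theorem hasTriple_transpose : HasTriple Dᵀ ↔ HasTriple D :=
  or_comm

theorem iff_of_reachable {V : Type*} {G : SimpleGraph V} {p : V → Prop}
    (hp : ∀ a b, G.Adj a b → (p a ↔ p b)) {a b : V} (h : G.Reachable a b) : p a ↔ p b := by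
  obtain ⟨w⟩ := h
  induction w with
  | nil => rfl
  | cons hab _ ih => exact (hp _ _ hab).trans ih

theorem rowConnected_of_preconnected_induce {u v : Y}
    (h : ((nonzeroGraph D).induce {.inr u, .inr v}ᶜ).Preconnected) :
    RowConnected D {j | j ≠ u ∧ j ≠ v} := by
  intro s t hst x x'
  refine iff_of_reachable (p := fun a => Sum.elim s t a.1) ?_
    (h ⟨.inl x, by simp⟩ ⟨.inl x', by simp⟩)
  rintro ⟨a | a, ha⟩ ⟨b | b, hb⟩ hab
  exacts [hab.elim, hst a b (by simpa using hb) hab, (hst b a (by simpa using ha) hab).symm,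
    hab.elim]

theorem rowConnected_transpose_of_preconnected_induce {u v : X}
    (h : ((nonzeroGraph D).induce {.inl u, .inl v}ᶜ).Preconnected) :
    RowConnected Dᵀ {i | i ≠ u ∧ i ≠ v} := by
  intro t s hts y y'
  refine iff_of_reachable (p := fun a => Sum.elim s t a.1) ?_
    (h ⟨.inr y, by simp⟩ ⟨.inr y', by simp⟩)
  rintro ⟨a | a, ha⟩ ⟨b | b, hb⟩ hab
  exacts [hab.elim, (hts b a (by simpa using ha) hab).symm, hts a b (by simpa using hb) hab,
    hab.elim]

namespace IsConnected

protected theorem transpose (h : IsConnected D) : IsConnected Dᵀ := fun t s hts =>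
  (h s t fun x y _ hxy => (hts y x (Set.mem_univ x) hxy).symm).imp And.symm And.symm

protected theorem pivot [DecidableEq X] [DecidableEq Y] [Nontrivial R] {H : Subgroup Rˣ}
    (h : IsConnected D) (hD : ∀ i j, UnitOrZero H (D i j)) {x : X} {y : Y} (hxy : D x y ≠ 0) :
    IsConnected (pivot D x y) :=
  fun s t hst => h s t (hst.of_pivot hD (Set.mem_univ y) hxy)

theorem preconnected_nonzeroGraph (h : IsConnected D) : (nonzeroGraph D).Preconnected := by
  intro a b
  have hsep : IsSeparation D Set.univ (fun x => (nonzeroGraph D).Reachable a (.inl x))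
      fun y => (nonzeroGraph D).Reachable a (.inr y) := by
    intro x y _ hxy
    have hadj : (nonzeroGraph D).Adj (.inl x) (.inr y) := hxy
    exact ⟨fun ha => ha.trans hadj.reachable, fun ha => ha.trans hadj.symm.reachable⟩
  obtain ⟨hX, hY⟩ | ⟨hX, hY⟩ := h _ _ hsep
  · cases b
    exacts [hX _, hY _]
  · cases a
    exacts [absurd .rfl (hX _), absurd .rfl (hY _)]

theorem exists_pair [Finite X] [Finite Y] (h : IsConnected D) (hD : HasTriple D) :
    (∃ u v, u ≠ v ∧ RowConnected D {j | j ≠ u ∧ j ≠ v}) ∨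
      ∃ u v, u ≠ v ∧ RowConnected Dᵀ {i | i ≠ u ∧ i ≠ v} := by
  obtain ⟨z, hz⟩ : ∃ z, 2 < ((nonzeroGraph D).neighborSet z).ncard := by
    obtain ⟨x, hx⟩ | ⟨y, hy⟩ := hD
    · rw [← Set.ncard_image_of_injective _ Sum.inr_injective] at hx
      exact ⟨.inl x, hx.trans_le (Set.ncard_le_ncard (Set.image_subset_iff.2 fun _ hj => hj))⟩
    · rw [← Set.ncard_image_of_injective _ Sum.inl_injective] at hy
      exact ⟨.inr y, hy.trans_le (Set.ncard_le_ncard (Set.image_subset_iff.2 fun _ hi => hi))⟩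
  have : Nonempty (X ⊕ Y) := ⟨z⟩
  obtain ⟨u | u, v | v, huv, hside, hG⟩ :=
    exists_ne_preconnected_induce_compl ⟨h.preconnected_nonzeroGraph⟩ hz Sum.isLeft
  · exact .inr ⟨u, v, ne_of_apply_ne _ huv, rowConnected_transpose_of_preconnected_induce hG⟩
  · cases hside
  · cases hside
  · exact .inl ⟨u, v, ne_of_apply_ne _ huv, rowConnected_of_preconnected_induce hG⟩

theorem card_le_two_of_square [Finite X] [Finite Y] (h : IsConnected D) (hD : ¬HasTriple D)
    {x x' : X} {y y' : Y} (hx : x ≠ x') (hy : y ≠ y') (h1 : D x y ≠ 0) (h2 : D x y' ≠ 0)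
    (h3 : D x' y ≠ 0) (h4 : D x' y' ≠ 0) : Nat.card X ≤ 2 ∧ Nat.card Y ≤ 2 := by
  have hrow : ∀ i j, D i y ≠ 0 → D i y' ≠ 0 → D i j ≠ 0 → j = y ∨ j = y' := by
    intro i j hiy hiy' hij
    by_contra! hj
    exact hD (.inl ⟨i, (Set.two_lt_ncard_iff).2 ⟨y, y', j, hiy, hiy', hij, hy, hj.1.symm,
      hj.2.symm⟩⟩)
  have hcol : ∀ i j, D x j ≠ 0 → D x' j ≠ 0 → D i j ≠ 0 → i = x ∨ i = x' := by
    intro i j hxj hxj' hij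
    by_contra! hi
    exact hD (.inr ⟨j, (Set.two_lt_ncard_iff).2 ⟨x, x', i, hxj, hxj', hij, hx, hi.1.symm,
      hi.2.symm⟩⟩)
  have hsep : IsSeparation D Set.univ (fun i => i = x ∨ i = x') fun j => j = y ∨ j = y' := by
    intro i j _ hij
    constructor
    · rintro (rfl | rfl)
      exacts [hrow _ _ h1 h2 hij, hrow _ _ h3 h4 hij]
    · rintro (rfl | rfl)
      exacts [hcol _ _ h1 h3 hij, hcol _ _ h2 h4 hij]
  obtain ⟨hX, hY⟩ | ⟨hX, -⟩ := h _ _ hsep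
  · rw [← Set.ncard_univ, ← Set.ncard_univ]
    exact ⟨(Set.ncard_le_ncard fun i _ => hX i).trans (Set.ncard_pair hx).le,
      (Set.ncard_le_ncard fun j _ => hY j).trans (Set.ncard_pair hy).le⟩
  · exact absurd (.inl rfl) (hX x)

theorem card_le_two_of_star (h : IsConnected D) (hD : ¬HasTriple D) {x : X} {y : Y}
    (hxy : D x y ≠ 0) (hy : ∀ i j, D i y ≠ 0 → D i j ≠ 0 → j = y) :
    Nat.card X ≤ 2 ∧ Nat.card Y ≤ 2 := by
  obtain ⟨hX, hY⟩ | ⟨hX, -⟩ := h (fun i => D i y ≠ 0) (fun j => j = y) fun i j _ hij =>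
    ⟨fun hi => hy i j hi hij, fun hj => hj ▸ hij⟩
  · have : Subsingleton Y := ⟨fun j j' => (hY j).trans (hY j').symm⟩
    have hY1 : Nat.card Y ≤ 1 := Finite.card_le_one_iff_subsingleton.2 this
    refine ⟨not_lt.1 fun hcard => hD (.inr ⟨y, ?_⟩), by omega⟩
    rwa [show {i | D i y ≠ 0} = Set.univ from Set.eq_univ_of_forall hX, Set.ncard_univ]
  · exact absurd hxy (hX x)

/- If the graph has a path of three edges, then `D` or its pivot at the middle edge contains a
square; otherwise the graph is a star. -/
theorem card_le_two [Finite X] [Finite Y] [DecidableEq X] [DecidableEq Y] [Nontrivial R]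
    {H : Subgroup Rˣ} (h : IsConnected D) (h0 : D ≠ 0) (hH : ∀ i j, UnitOrZero H (D i j))
    (hD : ¬HasTriple D) (hD' : ∀ x y, D x y ≠ 0 → ¬HasTriple (PartialField.pivot D x y)) :
    Nat.card X ≤ 2 ∧ Nat.card Y ≤ 2 := by
  by_cases hpath : ∃ x x' y y', x ≠ x' ∧ y ≠ y' ∧ D x y ≠ 0 ∧ D x y' ≠ 0 ∧ D x' y ≠ 0
  · obtain ⟨x, x', y, y', hx, hy, h1, h2, h3⟩ := hpath
    by_cases h4 : D x' y' = 0
    · have hinv := (hH _ _).inverse_ne_zero h1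
      refine (h.pivot hH h1).card_le_two_of_square (hD' x y h1) hx hy ?_ ?_ ?_ ?_
      · rwa [pivot_self]
      · rw [pivot_row _ hy.symm]
        exact (hH _ _).inverse.mul_ne_zero hinv h2
      · rw [pivot_col _ hx.symm, neg_ne_zero]
        exact (hH _ _).mul_ne_zero h3 hinv
      · rw [pivot_of_ne _ hx.symm hy.symm, h4, zero_sub, neg_ne_zero]
        exact ((hH _ _).mul (hH _ _).inverse).mul_ne_zero ((hH _ _).mul_ne_zero h3 hinv) h2
    · exact h.card_le_two_of_square hD hx hy h1 h2 h3 h4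
  obtain ⟨x, y, hxy⟩ : ∃ x y, D x y ≠ 0 := by
    by_contra! hcon
    exact h0 (Matrix.ext hcon)
  by_cases! hx : ∀ y', D x y' ≠ 0 → y' = y
  · refine h.card_le_two_of_star hD hxy fun i j hi hij => ?_
    by_contra! hj
    obtain rfl | hix := eq_or_ne i x
    · exact hj (hx j hij)
    · exact hpath ⟨i, x, y, j, hix, hj.symm, hi, hij, hxy⟩
  · obtain ⟨y', hxy', hy'⟩ := hx
    refine (h.transpose.card_le_two_of_star (mt hasTriple_transpose.1 hD) (x := y) (y := x) hxy
      fun j i hj hij => ?_).symm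
    by_contra! hi
    obtain rfl | hjy := eq_or_ne j y
    · exact hpath ⟨x, i, j, y', hi.symm, hy'.symm, hxy, hxy', hij⟩
    · exact hpath ⟨x, i, j, y, hi.symm, hjy, hj, hxy, hij⟩

end IsConnected

end Connected

section Blocks

variable {R : Type*} [CommRing R] {X Y : Type*} {s : X → Prop} {t : Y → Prop}

namespace IsSeparation

variable {D : Matrix X Y R} {T : Set Y}

theorem eq_zero (h : IsSeparation D Set.univ s t) {x : X} {y : Y} (hxy : ¬(s x ↔ t y)) :
    D x y = 0 := by
  by_contra h0
  exact hxy (h x y (Set.mem_univ y) h0)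

variable [DecidableEq X] [DecidableEq Y]

protected theorem pivot (h : IsSeparation D T s t) {x : X} {y : Y} (hy : y ∈ T)
    (hxy : D x y ≠ 0) : IsSeparation (pivot D x y) T s t := by
  intro i j hj hij
  obtain rfl | hi := eq_or_ne i x
  · obtain rfl | hjy := eq_or_ne j y
    · exact h i j hj hxy
    · rw [pivot_row _ hjy] at hij
      exact h i j hj (right_ne_zero_of_mul hij)
  obtain rfl | hjy := eq_or_ne j y
  · rw [pivot_col _ hi, neg_ne_zero] at hij
    exact h i j hj (left_ne_zero_of_mul hij)
  rw [pivot_of_ne _ hi hjy] at hij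
  by_cases h0 : D i j = 0
  · rw [h0, zero_sub, neg_ne_zero] at hij
    rw [h i y hy (left_ne_zero_of_mul (left_ne_zero_of_mul hij)), ← h x y hy hxy,
      h x j hj (right_ne_zero_of_mul hij)]
  · exact h i j hj h0

end IsSeparation

variable {K : Subgroup Rˣ}

theorem pivot_toBlock_eq_self [DecidableEq X] [DecidableEq Y] {D : Matrix X Y R} {x : X} {y : Y}
    (hs : ∀ i, s i → i ≠ x ∧ D i y = 0) : (pivot D x y).toBlock s t = D.toBlock s t := by
  ext ⟨i, hi⟩ j
  exact pivot_of_row_eq_zero _ (hs i hi).1 (hs i hi).2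

/- Separated matrices with strong blocks are closed under pivoting, as a pivot in one block does not
change the other. -/
theorem isStrong_of_toBlock (hK : -1 ∈ K) {D : Matrix X Y R} (h : IsSeparation D Set.univ s t)
    (hst : IsStrong K (D.toBlock s t))
    (hst' : IsStrong K (D.toBlock (fun x => ¬s x) fun y => ¬t y)) : IsStrong K D := by
  classical
  refine isStrong_of_pivot_closed hK {E : Matrix X Y R | IsSeparation E Set.univ s t ∧
    IsStrong K (E.toBlock s t) ∧ IsStrong K (E.toBlock (fun x => ¬s x) fun y => ¬t y)}
    ?_ ?_ ⟨h, hst, hst'⟩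
  · rintro E ⟨h, hst, hst'⟩ x y
    by_cases hxy : s x ↔ t y
    · by_cases hx : s x
      · exact hst.apply ⟨x, hx⟩ ⟨y, hxy.1 hx⟩
      · exact hst'.apply ⟨x, hx⟩ ⟨y, mt hxy.2 hx⟩
    · exact .inl (h.eq_zero hxy)
  · rintro E ⟨h, hst, hst'⟩ x y hxy
    have hiff := h x y (Set.mem_univ y) hxy
    refine ⟨h.pivot (Set.mem_univ y) hxy, ?_⟩
    by_cases hx : s x
    · have hy := hiff.1 hx
      have hstab : ∀ i, ¬s i → i ≠ x ∧ E i y = 0 := fun i hi =>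
        ⟨fun hix => hi (hix ▸ hx), h.eq_zero fun hiff => hi (hiff.2 hy)⟩
      have hpivot := hst.pivot hK (x := ⟨x, hx⟩) (y := ⟨y, hy⟩) hxy
      rw [toBlock, pivot_submatrix E Subtype.val_injective Subtype.val_injective] at hpivot
      exact ⟨hpivot, pivot_toBlock_eq_self hstab ▸ hst'⟩
    · have hy := mt hiff.2 hx
      have hstab : ∀ i, s i → i ≠ x ∧ E i y = 0 := fun i hi =>
        ⟨fun hix => hx (hix ▸ hi), h.eq_zero fun hiff => hy (hiff.1 hi)⟩
      have hpivot := hst'.pivot hK (x := ⟨x, hx⟩) (y := ⟨y, hy⟩) hxy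
      rw [toBlock, pivot_submatrix E Subtype.val_injective Subtype.val_injective] at hpivot
      exact ⟨pivot_toBlock_eq_self hstab ▸ hst, hpivot⟩

theorem hasStrongLift_of_toBlock {S : Type*} [CommRing S] {φ : S →+* R} {K : Subgroup Sˣ}
    (hK : -1 ∈ K) {D : Matrix X Y R} (h : IsSeparation D Set.univ s t)
    (hst : HasStrongLift φ K (D.toBlock s t))
    (hst' : HasStrongLift φ K (D.toBlock (fun x => ¬s x) fun y => ¬t y)) :
    HasStrongLift φ K D := by
  classical
  obtain ⟨A, hA, hAD⟩ := hst
  obtain ⟨B, hB, hBD⟩ := hst'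
  let E : Matrix X Y S := of fun i j =>
    if h : s i ∧ t j then A ⟨i, h.1⟩ ⟨j, h.2⟩
    else if h' : ¬s i ∧ ¬t j then B ⟨i, h'.1⟩ ⟨j, h'.2⟩ else 0
  have hEA : E.toBlock s t = A := by
    ext ⟨i, hi⟩ ⟨j, hj⟩
    simp [E, hi, hj]
  have hEB : E.toBlock (fun x => ¬s x) (fun y => ¬t y) = B := by
    ext ⟨i, hi⟩ ⟨j, hj⟩
    simp [E, hi, hj]
  have hE : ∀ i j, ¬(s i ↔ t j) → E i j = 0 := fun i j hij => by
    simp only [E, of_apply]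
    rw [dif_neg (by tauto), dif_neg (by tauto)]
  refine ⟨E, isStrong_of_toBlock hK (s := s) (t := t) (fun i j _ hij => not_not.1 (mt (hE i j) hij))
    (hEA ▸ hA) (hEB ▸ hB), ?_⟩
  ext i j
  rw [map_apply]
  by_cases hij : s i ↔ t j
  · by_cases hi : s i
    · exact congrFun (congrFun (hEA ▸ hAD) ⟨i, hi⟩) ⟨j, hij.1 hi⟩
    · exact congrFun (congrFun (hEB ▸ hBD) ⟨i, hi⟩) ⟨j, mt hij.2 hi⟩
  · rw [hE i j hij, map_zero, h.eq_zero hij]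

end Blocks

section SmallMatrices

variable {S : Type*} [CommRing S] {K : Subgroup Sˣ} {X Y : Type*}

theorem isStrong_zero : IsStrong K (0 : Matrix X Y S) := by
  rintro (_ | k) f g
  · rw [det_isEmpty]
    exact .one
  · rw [submatrix_zero, Pi.zero_apply, Pi.zero_apply, det_zero]
    exact .zero

theorem isStrong_of_card_le_two [Finite X] (hX : Nat.card X ≤ 2) {D : Matrix X Y S}
    (h1 : ∀ i j, UnitOrZero K (D i j))
    (h2 : ∀ i i' j j', i ≠ i' → j ≠ j' → UnitOrZero K (D i j * D i' j' - D i j' * D i' j)) :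
    IsStrong K D := by
  intro k f g
  refine unitOrZero_det_of_injective D f g fun hf hg => ?_
  have hk := Nat.card_le_card_of_injective f hf
  rw [Nat.card_fin] at hk
  match k with
  | 0 => simpa using UnitOrZero.one
  | 1 => simpa using h1 (f 0) (g 0)
  | 2 =>
    rw [det_fin_two]
    exact h2 _ _ _ _ (hf.ne Fin.zero_ne_one) (hg.ne Fin.zero_ne_one)
  | k + 3 => omega

theorem eq_or_eq_of_card_le_two [Finite X] (hX : Nat.card X ≤ 2) {a b : X} (hab : a ≠ b) (c : X) :
    c = a ∨ c = b := by
  by_contra! hc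
  have := Set.ncard_le_ncard (Set.subset_univ {a, b, c})
  rw [Set.ncard_eq_three.2 ⟨a, b, c, hab, hc.1.symm, hc.2.symm, rfl⟩, Set.ncard_univ] at this
  omega

theorem isStrong_of_det_two [Finite X] [Finite Y] (hK : -1 ∈ K) (hX : Nat.card X ≤ 2)
    (hY : Nat.card Y ≤ 2) {D : Matrix X Y S} (h1 : ∀ i j, UnitOrZero K (D i j)) {x x' : X}
    {y y' : Y} (hx : x ≠ x') (hy : y ≠ y')
    (hdet : UnitOrZero K (D x y * D x' y' - D x y' * D x' y)) : IsStrong K D := by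
  refine isStrong_of_card_le_two hX h1 fun i i' j j' hi hj => ?_
  have hdet' : UnitOrZero K (D x y' * D x' y - D x y * D x' y') := hdet.sub_comm hK
  have hrows : i = x ∧ i' = x' ∨ i = x' ∧ i' = x := by
    have := eq_or_eq_of_card_le_two hX hx i
    have := eq_or_eq_of_card_le_two hX hx i'
    grind
  have hcols : j = y ∧ j' = y' ∨ j = y' ∧ j' = y := by
    have := eq_or_eq_of_card_le_two hY hy j
    have := eq_or_eq_of_card_le_two hY hy j'
    grind
  obtain ⟨rfl, rfl⟩ | ⟨rfl, rfl⟩ := hrows <;> obtain ⟨rfl, rfl⟩ | ⟨rfl, rfl⟩ := hcols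
  exacts [hdet, hdet', by simpa only [mul_comm] using hdet', by simpa only [mul_comm] using hdet]

end SmallMatrices

section Lift

variable {S R : Type*} [CommRing S] [CommRing R] {φ : S →+* R} {K : Subgroup Sˣ}
  {H : Subgroup Rˣ}

theorem IsLifting.exists_map_eq (L : IsLifting φ K H) {X Y : Type*} {D : Matrix X Y R}
    (hD : ∀ i j, UnitOrZero H (D i j)) :
    ∃ E : Matrix X Y S, (∀ i j, UnitOrZero K (E i j)) ∧ E.map φ = D := by
  have hlift : ∀ i j, ∃ a : S, UnitOrZero K a ∧ φ a = D i j := by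
    intro i j
    obtain h0 | ⟨u, hu, h⟩ := hD i j
    · exact ⟨0, .zero, by rw [h0, map_zero]⟩
    · obtain ⟨v, hv, hvu⟩ := L.surj u hu
      exact ⟨v, .of_mem hv, hvu.trans h⟩
  choose E hE hED using hlift
  exact ⟨of E, hE, Matrix.ext hED⟩

protected theorem HasStrongLift.transpose {X Y : Type*} {D : Matrix X Y R}
    (h : HasStrongLift φ K D) : HasStrongLift φ K Dᵀ := by
  obtain ⟨E, hE, rfl⟩ := h
  exact ⟨Eᵀ, hE.transpose, transpose_map⟩

variable (φ K H) in
/-- All strong matrices with fewer rows and columns in total than `X` and `Y` have strong lifts: the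
induction hypothesis in the proof of the lifting theorem. -/
def SmallerLift (X Y : Type v) : Prop :=
  ∀ (X' Y' : Type v) [Finite X'] [Finite Y'] (D : Matrix X' Y' R),
    Nat.card X' + Nat.card Y' < Nat.card X + Nat.card Y → IsStrong H D → HasStrongLift φ K D

theorem IsStrong.hasStrongLift_of_not_isConnected {X Y : Type v} [Finite X] [Finite Y]
    {D : Matrix X Y R} (hK : -1 ∈ K) (hD : IsStrong H D) (ih : SmallerLift φ K H X Y)
    (hc : ¬IsConnected D) : HasStrongLift φ K D := by
  simp only [IsConnected, not_forall, not_or, not_and_or, not_not] at hc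
  obtain ⟨s, t, hst, hne, hne'⟩ := hc
  have hX := Finite.card_subtype_le s
  have hY := Finite.card_subtype_le t
  have hX' := Finite.card_subtype_le fun x => ¬s x
  have hY' := Finite.card_subtype_le fun y => ¬t y
  refine hasStrongLift_of_toBlock hK hst (ih _ _ _ ?_ (hD.submatrix _ _))
    (ih _ _ _ ?_ (hD.submatrix _ _))
  · obtain ⟨x, hx⟩ | ⟨y, hy⟩ := hne
    · exact add_lt_add_of_lt_of_le (Finite.card_subtype_lt hx) hY
    · exact add_lt_add_of_le_of_lt hX (Finite.card_subtype_lt hy)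
  · obtain ⟨x, hx⟩ | ⟨y, hy⟩ := hne'
    · exact add_lt_add_of_lt_of_le (Finite.card_subtype_lt (not_not.2 hx)) hY'
    · exact add_lt_add_of_le_of_lt hX' (Finite.card_subtype_lt (not_not.2 hy))

variable [Nontrivial R]

/- Lifts of three of the four entries and of the fundamental ratio determine a lift of the fourth
entry. -/
theorem hasStrongLift_of_full_square (L : IsLifting φ K H) {X Y : Type*} [Finite X] [Finite Y]
    (hX : Nat.card X ≤ 2) (hY : Nat.card Y ≤ 2) {D : Matrix X Y R} (hD : IsStrong H D) {x x' : X}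
    {y y' : Y} (hx : x ≠ x') (hy : y ≠ y') (h1 : D x y ≠ 0) (h2 : D x y' ≠ 0) (h3 : D x' y ≠ 0)
    (h4 : D x' y' ≠ 0) : HasStrongLift φ K D := by
  classical
  obtain ⟨E, hE, rfl⟩ := L.exists_map_eq hD.apply
  obtain ⟨f, hf, hfD⟩ := hD.hasFundamentalRatio L.neg_one_mem_target h1 h2 h3 h4
  obtain ⟨g, hg, rfl⟩ := L.exists_fundamental f hf
  have hunit := (hE x y).mul_inverse fun h0 => h1 (by rw [map_apply, h0, map_zero])
  let e := g * (E x y' * E x' y) * Ring.inverse (E x y)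
  have he : UnitOrZero K e := (hg.1.mul ((hE _ _).mul (hE _ _))).mul (hE _ _).inverse
  have hge : g * (E x y' * E x' y) = E x y * e := by
    linear_combination -(g * (E x y' * E x' y)) * hunit
  have hφe : φ e = φ (E x' y') := by
    refine ((hD.apply x y).isUnit h1).mul_right_inj.1 ?_
    simp only [map_apply] at hfD ⊢
    rw [← hfD, ← map_mul, ← hge, map_mul, map_mul]
  let F : Matrix X Y S := of fun i j => if i = x' ∧ j = y' then e else E i j
  have hF_apply : ∀ i j, F i j = if i = x' ∧ j = y' then e else E i j := fun i j => rfl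
  have hF : ∀ i j, UnitOrZero K (F i j) := fun i j => by
    rw [hF_apply]
    split_ifs
    exacts [he, hE i j]
  refine ⟨F, isStrong_of_det_two L.neg_one_mem_source hX hY hF hx hy ?_, ?_⟩
  · exact HasFundamentalRatio.det L.neg_one_mem_source hF
      ⟨g, hg, by simpa [hF_apply, hx, hy] using hge⟩
  · ext i j
    rw [map_apply, map_apply, hF_apply]
    split_ifs with hij
    · rw [hφe, hij.1, hij.2]
    · rfl

theorem hasStrongLift_of_card_le_two (L : IsLifting φ K H) {X Y : Type*} [Finite X] [Finite Y]
    (hX : Nat.card X ≤ 2) (hY : Nat.card Y ≤ 2) {D : Matrix X Y R} (hD : IsStrong H D) :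
    HasStrongLift φ K D := by
  by_cases hfull : ∃ x x' y y', x ≠ x' ∧ y ≠ y' ∧ D x y ≠ 0 ∧ D x y' ≠ 0 ∧ D x' y ≠ 0 ∧ D x' y' ≠ 0
  · obtain ⟨x, x', y, y', hx, hy, h1, h2, h3, h4⟩ := hfull
    exact hasStrongLift_of_full_square L hX hY hD hx hy h1 h2 h3 h4
  obtain ⟨E, hE, rfl⟩ := L.exists_map_eq hD.apply
  refine ⟨E, isStrong_of_card_le_two hX hE fun i i' j j' hi hj => ?_, rfl⟩
  refine .sub_of_eq_zero L.neg_one_mem_source ((hE _ _).mul (hE _ _)) ((hE _ _).mul (hE _ _)) ?_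
  by_contra! hne
  have hmap : ∀ {a b}, E a b ≠ 0 → E.map φ a b ≠ 0 := fun h => mt (hE _ _).map_eq_zero.1 h
  exact hfull ⟨i, i', j, j', hi, hj, hmap (left_ne_zero_of_mul hne.1),
    hmap (left_ne_zero_of_mul hne.2), hmap (right_ne_zero_of_mul hne.2),
    hmap (right_ne_zero_of_mul hne.1)⟩

theorem HasStrongLift.of_pivot {X Y : Type*} {D : Matrix X Y R} [DecidableEq X]
    [DecidableEq Y] (hK : -1 ∈ K) {x : X} {y : Y} (hD : UnitOrZero H (D x y)) (h0 : D x y ≠ 0)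
    (h : HasStrongLift φ K (pivot D x y)) : HasStrongLift φ K D := by
  obtain ⟨E, hE, hED⟩ := h
  have hEDxy : φ (E x y) = Ring.inverse (D x y) := by
    rw [← pivot_self D, ← hED, map_apply]
  have hExy : E x y ≠ 0 := fun h => hD.inverse_ne_zero h0 (by rw [← hEDxy, h, map_zero])
  refine ⟨pivot E x y, hE.pivot hK hExy, ?_⟩
  rw [pivot_map _ _ ((hE.apply _ _).isUnit hExy), hED, pivot_pivot _ (hD.isUnit h0)]

section Induction

variable {X Y : Type v} [Finite X] [Finite Y] {D : Matrix X Y R} [Nontrivial S]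

theorem IsStrong.hasStrongLift_of_hasTriple (L : IsLifting φ K H) (hD : IsStrong H D)
    (ih : SmallerLift φ K H X Y) (hc : IsConnected D) (h3 : HasTriple D) :
    HasStrongLift φ K D := by
  have hlt {Z : Type v} [Finite Z] (w : Z) : Nat.card {z // z ≠ w} < Nat.card Z :=
    Finite.card_subtype_lt (x := w) (not_not.2 rfl)
  obtain ⟨u, v, huv, h⟩ | ⟨u, v, huv, h⟩ := hc.exists_pair h3
  · have hlift (w : Y) : HasStrongLift φ K (D.submatrix id (Subtype.val : {j // j ≠ w} → Y)) :=
      ih _ _ _ (Nat.add_lt_add_left (hlt w) _) (hD.submatrix _ _)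
    exact hasStrongLift_of_columns L hD huv h (hlift u) (hlift v)
  · have hlift (w : X) : HasStrongLift φ K (Dᵀ.submatrix id (Subtype.val : {i // i ≠ w} → X)) :=
      ih _ _ _ ((Nat.add_lt_add_left (hlt w) _).trans_eq (add_comm _ _))
        (hD.transpose.submatrix _ _)
    exact (hasStrongLift_of_columns L hD.transpose huv h (hlift u) (hlift v)).transpose

theorem IsStrong.hasStrongLift_of_smaller (L : IsLifting φ K H) (hD : IsStrong H D)
    (ih : SmallerLift φ K H X Y) : HasStrongLift φ K D := by
  classical
  by_cases hc : IsConnected D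
  swap
  · exact hD.hasStrongLift_of_not_isConnected L.neg_one_mem_source ih hc
  by_cases h3 : HasTriple D
  · exact hD.hasStrongLift_of_hasTriple L ih hc h3
  by_cases! hP : ∃ x y, D x y ≠ 0 ∧ HasTriple (pivot D x y)
  · obtain ⟨x, y, hxy, hP⟩ := hP
    exact .of_pivot L.neg_one_mem_source (hD.apply x y) hxy
      ((hD.pivot L.neg_one_mem_target hxy).hasStrongLift_of_hasTriple L ih
        (hc.pivot hD.apply hxy) hP)
  obtain rfl | h0 := eq_or_ne D 0
  · exact ⟨0, isStrong_zero, Matrix.map_zero φ (map_zero φ)⟩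
  obtain ⟨hX, hY⟩ := hc.card_le_two h0 hD.apply h3 hP
  exact hasStrongLift_of_card_le_two L hX hY hD

end Induction

/- The lifting theorem of Pendavingh and Van Zwam. -/
theorem IsStrong.hasStrongLift [Nontrivial S] (L : IsLifting φ K H) {X : Type u} {Y : Type v}
    [Finite X] [Finite Y] {D : Matrix X Y R} (hD : IsStrong H D) : HasStrongLift φ K D := by
  suffices hlift : ∀ (X Y : Type max u v) [Finite X] [Finite Y] (D : Matrix X Y R),
      IsStrong H D → HasStrongLift φ K D by
    obtain ⟨E, hE, hED⟩ := hlift _ _ (D.submatrix ULift.down ULift.down) (hD.submatrix _ _)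
    refine ⟨E.submatrix ULift.up ULift.up, hE.submatrix _ _, ?_⟩
    rw [← submatrix_map, hED, submatrix_submatrix]
    rfl
  intro X Y _ _ D hD
  induction h : Nat.card X + Nat.card Y using Nat.strong_induction_on generalizing X Y with
  | _ n ih =>
    subst h
    exact hD.hasStrongLift_of_smaller L fun _ _ _ _ _ hn hD' => ih _ hn _ _ _ hD' rfl

end Lift

section SumsTo

variable {P : Type*} [PartialField P] {S T : Multiset P} {p r s t : P}

theorem mem_padd_zero (p : P) : p ∈ padd p 0 := by
  rw [padd_zero]
  exact Part.mem_some p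

theorem neg_involutive : Function.Involutive (Neg.neg : P → P) := fun p =>
  (eq_neg_of_zero_mem_padd _ _ (padd_comm _ _ _ (zero_mem_padd_neg p))).symm

theorem mul_neg_eq (p q : P) : p * -q = -(p * q) := by
  obtain rfl | hp := eq_or_ne p 0
  · rw [zero_mul, zero_mul]
    exact eq_neg_of_zero_mem_padd _ _ (mem_padd_zero 0)
  · refine eq_neg_of_zero_mem_padd _ _ ?_
    rw [mul_padd _ _ _ hp, Part.mem_map_iff]
    exact ⟨0, zero_mem_padd_neg q, mul_zero p⟩

theorem Association.mul (hp : p ≠ 0) (h : Association padd S r) :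
    Association padd (S.map (p * ·)) (p * r) := by
  induction h with
  | leaf q => simpa only [Multiset.map_singleton] using Association.leaf (p * q)
  | node _ _ h3 ih1 ih2 =>
    rw [Multiset.map_add]
    refine .node ih1 ih2 ?_
    rw [mul_padd _ _ _ hp, Part.mem_map_iff]
    exact ⟨_, h3, rfl⟩

theorem sumsTo_singleton (p : P) : SumsTo {p} p :=
  ⟨0, by simpa only [Multiset.map_zero, add_zero] using Association.leaf p⟩

theorem sumsTo_zero : SumsTo (0 : Multiset P) 0 :=
  ⟨{1}, by simpa using Association.node (.leaf 1) (.leaf (-1)) (zero_mem_padd_neg (1 : P))⟩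

namespace SumsTo

theorem add (hS : SumsTo S r) (hT : SumsTo T s) (h : t ∈ padd r s) : SumsTo (S + T) t := by
  obtain ⟨Z, hZ⟩ := hS
  obtain ⟨W, hW⟩ := hT
  refine ⟨Z + W, ?_⟩
  convert Association.node hZ hW h using 1
  rw [Multiset.map_add]
  abel

theorem of_add_neg (h : SumsTo (S + (T + T.map fun z => -z)) r) : SumsTo S r := by
  obtain ⟨Z, hZ⟩ := h
  refine ⟨T + Z, ?_⟩
  convert hZ using 1
  rw [Multiset.map_add]
  abel

theorem map_zero (S : Multiset P) : SumsTo (S.map fun _ => (0 : P)) 0 := by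
  induction S using Multiset.induction_on with
  | empty => exact sumsTo_zero
  | cons a S ih =>
    rw [Multiset.map_cons, ← Multiset.singleton_add]
    exact (sumsTo_singleton 0).add ih (mem_padd_zero 0)

protected theorem mul (p : P) (h : SumsTo S r) : SumsTo (S.map (p * ·)) (p * r) := by
  obtain rfl | hp := eq_or_ne p 0
  · simpa only [zero_mul] using map_zero S
  obtain ⟨Z, hZ⟩ := h
  refine ⟨Z.map (p * ·), ?_⟩
  simpa only [Multiset.map_add, Multiset.map_map, Function.comp_def, mul_neg_eq] using
    Association.mul hp hZ

end SumsTo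

end SumsTo

section PreservesSums

variable {P : Type*} [PartialField P] {R : Type*} [CommRing R]

/-- The homomorphisms of partial fields from `P` to a ring: multiplicative maps that preserve all
defined sums. -/
def PreservesSums (f : P →* R) : Prop := ∀ ⦃p q r⦄, r ∈ padd p q → f r = f p + f q

theorem inverse_map {p : P} (f : P →* R) (hp : p ≠ 0) : Ring.inverse (f p) = f p⁻¹ := by
  have hu : f p * f p⁻¹ = 1 := by rw [← map_mul, mul_inv_cancel₀ hp, map_one]
  rw [← mul_one (Ring.inverse _), ← hu, Ring.inverse_mul_cancel_left _ _ (.of_mul_eq_one _ hu)]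

namespace PreservesSums

variable {f : P →* R} (hf : PreservesSums f)
include hf

theorem map_zero : f 0 = 0 := left_eq_add.1 (hf (mem_padd_zero 0))

theorem map_neg (p : P) : f (-p) = -f p := by
  rw [eq_neg_iff_add_eq_zero, add_comm, ← hf (zero_mem_padd_neg p), hf.map_zero]

theorem map_ne_zero_iff [Nontrivial R] {p : P} : f p ≠ 0 ↔ p ≠ 0 :=
  ⟨fun h h0 => h (by rw [h0, hf.map_zero]), fun h => ((isUnit_iff_ne_zero.2 h).map f).ne_zero⟩

theorem map_association {S : Multiset P} {r : P} (h : Association padd S r) :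
    f r = (S.map f).sum := by
  induction h with
  | leaf p => rw [Multiset.map_singleton, Multiset.sum_singleton]
  | node _ _ h3 ih1 ih2 => rw [hf h3, ih1, ih2, Multiset.map_add, Multiset.sum_add]

theorem map_sumsTo {S : Multiset P} {r : P} (h : SumsTo S r) : f r = (S.map f).sum := by
  obtain ⟨Z, hZ⟩ := h
  rw [hf.map_association hZ, Multiset.map_add, Multiset.map_add, Multiset.sum_add,
    Multiset.sum_add, Multiset.map_map]
  simp [hf.map_neg]

theorem sum_map_detTerms {n : Type*} [Fintype n] [DecidableEq n] (A : Matrix n n P) :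
    ((detTerms A).map f).sum = (A.map f).det := by
  rw [← det_transpose, det_apply', detTerms, Multiset.map_map]
  refine Finset.sum_congr rfl fun σ _ => ?_
  rw [Function.comp_apply]
  split_ifs with h
  · rw [h, map_prod]
    simp
  · rw [(Int.units_eq_one_or _).resolve_left h, hf.map_neg, map_prod]
    simp

theorem map_hasDet {n : Type*} [Fintype n] [DecidableEq n] {A : Matrix n n P} {d : P}
    (h : HasDet A d) : (A.map f).det = f d := by
  rw [hf.map_sumsTo h, hf.sum_map_detTerms]

end PreservesSums

end PreservesSums

section UniversalRing

variable {P : Type*} [PartialField P]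

/-- The formal sum of the members of `S`, in the monoid ring of `P`. -/
noncomputable def formalSum (S : Multiset P) : MonoidAlgebra ℤ P :=
  (S.map (MonoidAlgebra.of ℤ P)).sum

@[simp] theorem formalSum_singleton (p : P) : formalSum {p} = MonoidAlgebra.of ℤ P p := by
  rw [formalSum, Multiset.map_singleton, Multiset.sum_singleton]

@[simp] theorem formalSum_add (S T : Multiset P) :
    formalSum (S + T) = formalSum S + formalSum T := by
  rw [formalSum, Multiset.map_add, Multiset.sum_add, formalSum, formalSum]

theorem of_mul_formalSum (p : P) (S : Multiset P) :
    MonoidAlgebra.of ℤ P p * formalSum S = formalSum (S.map (p * ·)) := by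
  rw [formalSum, formalSum, ← Multiset.sum_map_mul_left, Multiset.map_map]
  simp only [Function.comp_def, map_mul]

theorem coeff_formalSum [DecidableEq P] (S : Multiset P) (p : P) :
    (formalSum S).coeff p = S.count p := by
  induction S using Multiset.induction_on with
  | empty => simp [formalSum]
  | cons a S ih =>
    rw [← Multiset.singleton_add, formalSum_add, MonoidAlgebra.coeff_add, Finsupp.add_apply, ih,
      Multiset.count_add, Multiset.count_singleton]
    simp [Finsupp.single_apply, eq_comm]

theorem formalSum_injective : Function.Injective (formalSum (P := P)) := by
  classical
  intro S T h
  ext p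
  have := coeff_formalSum S p
  rw [h, coeff_formalSum] at this
  exact_mod_cast this.symm

variable (P) in
/-- The differences of formal sums `S - T` for which the sum of `S` and `-T` is defined and equal
to zero in `P`. -/
noncomputable def nullAddSubgroup : AddSubgroup (MonoidAlgebra ℤ P) where
  carrier := {x | ∃ S T : Multiset P, x = formalSum S - formalSum T ∧
    SumsTo (S + T.map fun z => -z) 0}
  zero_mem' := ⟨0, 0, (sub_self _).symm, sumsTo_zero⟩
  add_mem' := by
    rintro _ _ ⟨S, T, rfl, h⟩ ⟨S', T', rfl, h'⟩
    refine ⟨S + S', T + T', by rw [formalSum_add, formalSum_add, add_sub_add_comm], ?_⟩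
    rw [Multiset.map_add, add_add_add_comm]
    exact h.add h' (mem_padd_zero 0)
  neg_mem' := by
    rintro _ ⟨S, T, rfl, h⟩
    refine ⟨T, S, neg_sub _ _, ?_⟩
    have hneg : ((-1 : P) * ·) = Neg.neg := funext fun q => by
      rw [mul_comm, mul_neg_eq, mul_one]
    have := h.mul (-1)
    rw [mul_zero, hneg, Multiset.map_add, Multiset.map_map, add_comm] at this
    simpa only [Function.comp_def, neg_involutive _, Multiset.map_id'] using this

theorem of_mul_mem_nullAddSubgroup (p : P) {x : MonoidAlgebra ℤ P} (hx : x ∈ nullAddSubgroup P) :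
    MonoidAlgebra.of ℤ P p * x ∈ nullAddSubgroup P := by
  obtain ⟨S, T, rfl, h⟩ := hx
  refine ⟨S.map (p * ·), T.map (p * ·), by rw [mul_sub, of_mul_formalSum, of_mul_formalSum], ?_⟩
  simpa only [Multiset.map_add, Multiset.map_map, mul_neg_eq, Function.comp_def, mul_zero]
    using h.mul p

theorem mul_mem_nullAddSubgroup (a : MonoidAlgebra ℤ P) {x : MonoidAlgebra ℤ P}
    (hx : x ∈ nullAddSubgroup P) : a * x ∈ nullAddSubgroup P := by
  induction a using MonoidAlgebra.induction_on with
  | of p => exact of_mul_mem_nullAddSubgroup p hx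
  | add a b ha hb => exact add_mul a b x ▸ add_mem ha hb
  | smul n a ha => exact smul_mul_assoc n a x ▸ zsmul_mem ha n

variable (P) in
/-- The ideal of the relations between the elements of `P` that follow from its defined sums. -/
noncomputable def nullIdeal : Ideal (MonoidAlgebra ℤ P) where
  __ := nullAddSubgroup P
  smul_mem' a _ hx := mul_mem_nullAddSubgroup a hx

variable (P) in
/-- The ring with the property that every sum-preserving map from `P` to a ring factors uniquely
through it. -/
abbrev UniversalRing : Type _ := MonoidAlgebra ℤ P ⧸ nullIdeal P

/-- The canonical map from `P` to its universal ring. -/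
noncomputable def toUniversal : P →* UniversalRing P :=
  (Ideal.Quotient.mk (nullIdeal P) : MonoidAlgebra ℤ P →* UniversalRing P).comp
    (MonoidAlgebra.of ℤ P)

theorem preservesSums_toUniversal : PreservesSums (toUniversal (P := P)) := by
  intro p q r h
  have hmem : MonoidAlgebra.of ℤ P p + MonoidAlgebra.of ℤ P q - MonoidAlgebra.of ℤ P r ∈
      nullIdeal P :=
    ⟨{p} + {q}, {r}, by simp only [formalSum_add, formalSum_singleton],
      ((sumsTo_singleton p).add (sumsTo_singleton q) h).add (sumsTo_singleton (-r))
        (zero_mem_padd_neg r)⟩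
  exact (Ideal.Quotient.eq.2 hmem).symm

/- The relation `S - r = S' - T` in the free ring, where `S' - T` is null, says that `S` and `T`
together are `S'` and `r`. -/
theorem sumsTo_of_map_toUniversal {S : Multiset P} {r : P}
    (h : (S.map toUniversal).sum = toUniversal r) : SumsTo S r := by
  have hmk : Ideal.Quotient.mk (nullIdeal P) (formalSum S) =
      Ideal.Quotient.mk (nullIdeal P) (MonoidAlgebra.of ℤ P r) := by
    rw [formalSum, map_multiset_sum, Multiset.map_map]
    exact h
  obtain ⟨S', T, hST, hnull⟩ := Ideal.Quotient.eq.1 hmk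
  have hS : S + T = S' + {r} := by
    apply formalSum_injective
    rw [formalSum_add, formalSum_add, formalSum_singleton]
    linear_combination hST
  have hsum := (sumsTo_singleton r).add hnull (mem_padd_zero r)
  refine SumsTo.of_add_neg (T := T) ?_
  rwa [← add_assoc, hS, add_comm S', add_assoc]

theorem hasDet_of_map_toUniversal {n : Type*} [Fintype n] [DecidableEq n] {A : Matrix n n P}
    {d : P} (h : (A.map toUniversal).det = toUniversal d) : HasDet A d :=
  sumsTo_of_map_toUniversal (by
    rw [(preservesSums_toUniversal (P := P)).sum_map_detTerms, h])

end UniversalRing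

section Embedding

variable {P : Type*} [PartialField P] {R : Type*} [CommRing R]

/-- Embeddings of a partial field in a ring, with image `H ∪ {0}`, such that a sum is defined
whenever its value is in the image. -/
structure IsEmbedding (f : P →* R) (H : Subgroup Rˣ) : Prop where
  neg_one_mem : -1 ∈ H
  unitOrZero_iff : ∀ {x}, UnitOrZero H x ↔ ∃ p, f p = x
  mem_padd_iff : ∀ {p q r}, r ∈ padd p q ↔ f r = f p + f q

namespace IsEmbedding

variable {f : P →* R} {H : Subgroup Rˣ} (hf : IsEmbedding f H)
include hf

theorem preservesSums : PreservesSums f := fun _ _ _ => hf.mem_padd_iff.1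

theorem unitOrZero (p : P) : UnitOrZero H (f p) := hf.unitOrZero_iff.2 ⟨p, rfl⟩

protected theorem injective : Function.Injective f := by
  intro p q h
  have := hf.mem_padd_iff (p := p) (q := 0) (r := q)
  rw [hf.preservesSums.map_zero, add_zero, padd_zero, Part.mem_some_iff] at this
  exact (this.2 h.symm).symm

theorem map_eq_pivot {S : Type*} [CommRing S] {u : P →* S} (hu : PreservesSums u)
    {X Y : Type*} [DecidableEq X] [DecidableEq Y] {A B : Matrix X Y P} {x : X} {y : Y}
    (hxy : A x y ≠ 0) (h : B.map f = pivot (A.map f) x y) : B.map u = pivot (A.map u) x y := by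
  ext i j
  have hij := congr_fun₂ h i j
  obtain rfl | hi := eq_or_ne i x <;> obtain rfl | hj := eq_or_ne j y
  · simp only [pivot_self, map_apply, inverse_map _ hxy] at hij ⊢
    rw [hf.injective hij]
  · simp only [pivot_row _ hj, map_apply, inverse_map _ hxy, ← map_mul] at hij ⊢
    rw [hf.injective hij]
  · simp only [pivot_col _ hi, map_apply, inverse_map _ hxy, ← map_mul,
      ← hf.preservesSums.map_neg, ← hu.map_neg] at hij ⊢
    rw [hf.injective hij]
  · simp only [pivot_of_ne _ hi hj, map_apply, inverse_map _ hxy, ← map_mul, sub_eq_add_neg,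
      ← hf.preservesSums.map_neg, ← hu.map_neg] at hij ⊢
    exact hu (hf.mem_padd_iff.2 hij)

theorem exists_map_eq {X Y : Type*} {D : Matrix X Y R} (hD : ∀ i j, UnitOrZero H (D i j)) :
    ∃ A : Matrix X Y P, A.map f = D := by
  choose A hA using fun i j => hf.unitOrZero_iff.1 (hD i j)
  exact ⟨of A, Matrix.ext hA⟩

theorem isStrong_map_toUniversal [Nontrivial R] {X Y : Type*} {A : Matrix X Y P}
    (hA : IsStrong H (A.map f)) :
    IsStrong (Units.map (toUniversal (P := P))).range (A.map toUniversal) := by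
  classical
  have hu := preservesSums_toUniversal (P := P)
  refine isStrong_of_pivot_closed ?_ {D | ∃ B, IsStrong H (B.map f) ∧ B.map toUniversal = D}
    ?_ ?_ ⟨A, hA, rfl⟩
  · refine ⟨Units.mk0 (-1) ((neg_ne_zero_iff _).2 one_ne_zero), Units.ext ?_⟩
    exact (hu.map_neg 1).trans (congrArg Neg.neg toUniversal.map_one)
  · rintro _ ⟨B, -, rfl⟩ x y
    rw [map_apply]
    obtain h0 | h0 := eq_or_ne (B x y) 0
    · exact .inl (by rw [h0, hu.map_zero])
    · exact .inr ⟨_, ⟨Units.mk0 _ h0, rfl⟩, rfl⟩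
  · rintro _ ⟨B, hB, rfl⟩ x y hxy
    have hBxy : B x y ≠ 0 := fun h => hxy (by rw [map_apply, h, hu.map_zero])
    have hpivot := hB.pivot hf.neg_one_mem (hf.preservesSums.map_ne_zero_iff.2 hBxy)
    obtain ⟨C, hC⟩ := hf.exists_map_eq hpivot.apply
    exact ⟨C, hC ▸ hpivot, hf.map_eq_pivot hu hBxy hC⟩

theorem exists_hasDet [Nontrivial R] {X Y : Type*} {A : Matrix X Y P} (hA : IsStrong H (A.map f))
    {k : ℕ} (g : Fin k → X) (h : Fin k → Y) : ∃ d, HasDet (A.submatrix g h) d := by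
  obtain h0 | ⟨_, ⟨p, rfl⟩, hp⟩ := hf.isStrong_map_toUniversal hA k g h
  · exact ⟨0, hasDet_of_map_toUniversal (h0.trans
      (preservesSums_toUniversal (P := P)).map_zero.symm)⟩
  · exact ⟨p, hasDet_of_map_toUniversal hp.symm⟩

end IsEmbedding

end Embedding

section Representation

variable {α : Type*} {M : Matroid α} {R : Type*} [CommRing R] {r : ℕ}

/-- The `r × E` matrix `D` over a ring represents `M`: the bases of `M` are the sets of `r` columns
of `D` whose maximal minor is nonzero. -/
structure IsRepresentedBy (M : Matroid α) (D : Matrix (Fin r) M.E R) : Prop where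
  exists_range_eq : ∀ B, M.IsBase B → ∃ g : Fin r ↪ M.E, ((↑) '' Set.range g : Set α) = B
  isBase_iff : ∀ g : Fin r ↪ M.E,
    M.IsBase ((↑) '' Set.range g : Set α) ↔ (D.submatrix id g).det ≠ 0

theorem IsRepresentedBy.exists_isBase {D : Matrix (Fin r) M.E R} (h : IsRepresentedBy M D) :
    ∃ g : Fin r ↪ M.E, M.IsBase ((↑) '' Set.range g : Set α) := by
  obtain ⟨B, hB⟩ := M.exists_isBase
  obtain ⟨g, rfl⟩ := h.exists_range_eq B hB
  exact ⟨g, hB⟩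

theorem IsRepresentedBy.eq_of_isBase {r' : ℕ} {D : Matrix (Fin r) M.E R} (h : IsRepresentedBy M D)
    {g : Fin r' ↪ M.E} (hg : M.IsBase ((↑) '' Set.range g : Set α)) : r = r' := by
  obtain ⟨g', hg'⟩ := h.exists_range_eq _ hg
  simpa only [Set.ncard_image_of_injective _ Subtype.val_injective,
    Set.ncard_range_of_injective (Function.Embedding.injective _), Nat.card_fin] using
    congrArg Set.ncard hg'

theorem det_submatrix_eq_zero_iff_of_range_eq {n E : Type*} [Fintype n] [DecidableEq n]
    (D : Matrix n E R) {g h : n ↪ E} (hgh : Set.range g = Set.range h) :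
    (D.submatrix id g).det = 0 ↔ (D.submatrix id h).det = 0 := by
  let σ : Equiv.Perm n := (Equiv.ofInjective g g.injective).trans
    ((Equiv.setCongr hgh).trans (Equiv.ofInjective h h.injective).symm)
  have hσ : h ∘ σ = g := funext fun i => Equiv.apply_ofInjective_symm h.injective _
  have hD : D.submatrix id g = (D.submatrix id h).submatrix id σ := by
    rw [submatrix_submatrix, hσ, Function.comp_id]
  rw [hD, det_permute']
  exact ((Equiv.Perm.sign σ).isUnit.map (Int.castRingHom R)).mul_right_eq_zero

section PartialFieldMatrix

variable {P : Type*} [PartialField P] [Nontrivial R] {f : P →* R}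

theorem PreservesSums.exists_hasDet_ne_zero_iff (hf : PreservesSums f) {n : Type*} [Fintype n]
    [DecidableEq n] {A : Matrix n n P} (hA : ∃ d, HasDet A d) :
    (∃ d, HasDet A d ∧ d ≠ 0) ↔ (A.map f).det ≠ 0 := by
  constructor
  · rintro ⟨d, hd, hd0⟩
    rwa [hf.map_hasDet hd, hf.map_ne_zero_iff]
  · obtain ⟨d, hd⟩ := hA
    intro h
    exact ⟨d, hd, by rwa [hf.map_hasDet hd, hf.map_ne_zero_iff] at h⟩

theorem PreservesSums.range_mem_bases_iff (hf : PreservesSums f) {E : Type*}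
    {A : Matrix (Fin r) E P} (hA : IsPMatrix A) (g : Fin r ↪ E) :
    Set.range g ∈ bases A ↔ ((A.map f).submatrix id g).det ≠ 0 := by
  have hdet (h : Fin r ↪ E) : (∃ d, HasDet (A.submatrix id h) d ∧ d ≠ 0) ↔
      ((A.map f).submatrix id h).det ≠ 0 :=
    hf.exists_hasDet_ne_zero_iff (hA r (.refl _) h)
  constructor
  · rintro ⟨h, hgh, hd⟩
    exact mt (det_submatrix_eq_zero_iff_of_range_eq _ hgh).2 ((hdet h).1 hd)
  · exact fun h => ⟨g, rfl, (hdet g).2 h⟩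

theorem rank_eq_of_mem_bases {E : Type*} {A : Matrix (Fin r) E P} {B : Set E} (hB : B ∈ bases A) :
    rank A = r := by
  obtain ⟨g, -, d, hd⟩ := hB
  refine IsGreatest.csSup_eq ⟨⟨.refl _, g, d, hd⟩, ?_⟩
  rintro k ⟨g, -⟩
  simpa only [Fintype.card_fin] using Fintype.card_le_of_embedding g

theorem isRepresentedBy_map_iff (hf : PreservesSums f) {A : Matrix (Fin r) M.E P}
    (hA : IsPMatrix A) : IsRepresentedBy M (A.map f) ↔
      ∀ B : Set M.E, M.IsBase ((↑) '' B : Set α) ↔ B ∈ bases A := by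
  refine ⟨fun h B => ⟨fun hB => ?_, ?_⟩, fun h => ⟨fun B hB => ?_, fun g => ?_⟩⟩
  · obtain ⟨g, hg⟩ := h.exists_range_eq _ hB
    obtain rfl := Subtype.val_injective.image_injective hg
    exact (hf.range_mem_bases_iff hA g).2 ((h.isBase_iff g).1 hB)
  · rintro ⟨g, rfl, hd⟩
    exact (h.isBase_iff g).2 ((hf.range_mem_bases_iff hA g).1 ⟨g, rfl, hd⟩)
  · have hB' : Subtype.val '' (Subtype.val ⁻¹' B : Set M.E) = B := by
      rw [Subtype.image_preimage_coe, Set.inter_eq_right.2 hB.subset_ground]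
    obtain ⟨g, hg, -⟩ := (h _).1 (hB'.symm ▸ hB)
    exact ⟨g, by rw [hg, hB']⟩
  · rw [h, hf.range_mem_bases_iff hA]

theorem PreservesSums.exists_isRepresentedBy (hf : PreservesSums f)
    (h : M.IsRepresentableOver P) :
    ∃ (r : ℕ) (A : Matrix (Fin r) M.E P), IsPMatrix A ∧ IsRepresentedBy M (A.map f) := by
  obtain ⟨r, A, hA, -, hb⟩ := h
  exact ⟨r, A, hA, (isRepresentedBy_map_iff hf hA).2 hb⟩

theorem IsEmbedding.isRepresentableOver {H : Subgroup Rˣ} (hf : IsEmbedding f H)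
    {D : Matrix (Fin r) M.E R} (hD : IsStrong H D) (hM : IsRepresentedBy M D) :
    M.IsRepresentableOver P := by
  obtain ⟨A, rfl⟩ := hf.exists_map_eq hD.apply
  have hA : IsPMatrix A := fun _ g h => hf.exists_hasDet hD g h
  have hb := (isRepresentedBy_map_iff hf.preservesSums hA).1 hM
  obtain ⟨g, hg⟩ := hM.exists_isBase
  exact ⟨r, A, hA, rank_eq_of_mem_bases ((hb _).1 hg), hb⟩

end PartialFieldMatrix

section StandardForm

variable {H : Subgroup Rˣ}

theorem isStrong_of_submatrix_eq_one {X Y : Type*} [DecidableEq X] [Fintype X] {D : Matrix X Y R}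
    {g₀ : X → Y} (h1 : D.submatrix id g₀ = 1)
    (h : ∀ g : X → Y, UnitOrZero H (D.submatrix id g).det) : IsStrong H D := by
  refine isStrong_of_det_fromCols_one fun g => ?_
  have hD : fromCols 1 D = D.submatrix id (Sum.elim g₀ id) := by
    rw [← h1]
    ext i (j | j) <;> rfl
  rw [hD, submatrix_submatrix]
  exact h _

theorem IsRepresentedBy.exists_standard [Nontrivial R] {D : Matrix (Fin r) M.E R}
    (hM : IsRepresentedBy M D) (hD : ∀ g : Fin r → M.E, UnitOrZero H (D.submatrix id g).det)
    {g₀ : Fin r ↪ M.E} (hg₀ : M.IsBase ((↑) '' Set.range g₀ : Set α)) :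
    ∃ D' : Matrix (Fin r) M.E R, D'.submatrix id g₀ = 1 ∧ IsRepresentedBy M D' ∧ IsStrong H D' := by
  let C := D.submatrix id g₀
  have hC : C.det ≠ 0 := (hM.isBase_iff g₀).1 hg₀
  have hdet (g : Fin r → M.E) :
      ((C⁻¹ * D).submatrix id g).det = Ring.inverse C.det * (D.submatrix id g).det := by
    rw [← det_nonsing_inv, ← det_mul]
    rfl
  have hone : (C⁻¹ * D).submatrix id g₀ = 1 := nonsing_inv_mul C ((hD g₀).isUnit hC)
  refine ⟨C⁻¹ * D, hone, ⟨hM.exists_range_eq, fun g => ?_⟩,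
    isStrong_of_submatrix_eq_one hone fun g => ?_⟩
  · rw [hM.isBase_iff, hdet]
    exact ⟨(hD g₀).inverse.mul_ne_zero ((hD g₀).inverse_ne_zero hC), right_ne_zero_of_mul⟩
  · rw [hdet]
    exact (hD g₀).inverse.mul (hD g)

theorem IsEmbedding.exists_standard [Nontrivial R] {P : Type*} [PartialField P] {f : P →* R}
    (hf : IsEmbedding f H) (h : M.IsRepresentableOver P) {g₀ : Fin r ↪ M.E}
    (hg₀ : M.IsBase ((↑) '' Set.range g₀ : Set α)) :
    ∃ D : Matrix (Fin r) M.E R, D.submatrix id g₀ = 1 ∧ IsRepresentedBy M D ∧ IsStrong H D := by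
  obtain ⟨r', A, hA, hM⟩ := hf.preservesSums.exists_isRepresentedBy h
  obtain rfl := hM.eq_of_isBase hg₀
  refine hM.exists_standard (fun g => unitOrZero_det_of_injective _ id g fun _ hg => ?_) hg₀
  obtain ⟨d, hd⟩ := hA r' (.refl _) ⟨g, hg⟩
  exact (hf.preservesSums.map_hasDet hd).symm ▸ hf.unitOrZero d

end StandardForm

end Representation

section GoldenInteger

/-- The ring `ℤ[τ]`, where `τ ^ 2 = τ + 1`. The golden ratio partial field consists of `0` and the
units `±τ ^ k` of this ring. -/
abbrev GoldenInteger : Type := QuadraticAlgebra ℤ 1 1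

theorem mem_closure_pair_neg_one_iff {R : Type*} [CommRing R] {t u : Rˣ} :
    u ∈ Subgroup.closure {t, -1} ↔ ∃ n : ℤ, u = t ^ n ∨ u = -t ^ n := by
  rw [Subgroup.mem_closure_pair]
  constructor
  · rintro ⟨n, k, rfl⟩
    refine ⟨n, ?_⟩
    obtain hk | hk := k.even_or_odd
    · exact .inl (by rw [hk.neg_one_zpow, mul_one])
    · exact .inr (by rw [hk.neg_one_zpow, mul_neg, mul_one])
  · rintro ⟨n, rfl | rfl⟩
    · exact ⟨n, 0, by rw [zpow_zero, mul_one]⟩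
    · exact ⟨n, 1, by rw [zpow_one, mul_neg, mul_one]⟩

namespace GoldenInteger

/-- The ring homomorphism that sends `τ` to a root `x` of `x ^ 2 = 1 + x`. -/
def toRing {A : Type*} [CommRing A] (x : A) (hx : x * x = 1 + x) : GoldenInteger →+* A :=
  (QuadraticAlgebra.lift ⟨x, by simpa using hx⟩ : GoldenInteger →ₐ[ℤ] A).toRingHom

theorem toRing_apply {A : Type*} [CommRing A] (x : A) (hx : x * x = 1 + x) (z : GoldenInteger) :
    toRing x hx z = z.re + z.im * x := by
  simp [toRing, QuadraticAlgebra.lift]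

/-- The unit `τ` of `ℤ[τ]`. -/
def tau : GoldenIntegerˣ where
  val := ⟨0, 1⟩
  inv := ⟨-1, 1⟩
  val_inv := by decide
  inv_val := by decide

theorem toRing_tau {A : Type*} [CommRing A] (x : A) (hx : x * x = 1 + x) :
    toRing x hx (tau : GoldenInteger) = x := by
  simp [toRing_apply, tau]

/-- The units `±τ ^ k` of `ℤ[τ]`. -/
def units : Subgroup GoldenIntegerˣ := Subgroup.closure {tau, -1}

theorem neg_one_mem_units : -1 ∈ units := Subgroup.subset_closure (Or.inr rfl)

theorem unitOrZero_tau_zpow (n : ℤ) : UnitOrZero units ↑(tau ^ n) :=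
  .of_mem (mem_closure_pair_neg_one_iff.2 ⟨n, .inl rfl⟩)

theorem unitOrZero_neg_tau_zpow (n : ℤ) : UnitOrZero units (-↑(tau ^ n)) :=
  (unitOrZero_tau_zpow n).neg neg_one_mem_units

theorem unitOrZero_units_iff {z : GoldenInteger} : UnitOrZero units z ↔
    z = 0 ∨ ∃ n : ℤ, z = ↑(tau ^ n) ∨ z = -↑(tau ^ n) := by
  constructor
  · rintro (rfl | ⟨u, hu, rfl⟩)
    · exact .inl rfl
    · obtain ⟨n, rfl | rfl⟩ := mem_closure_pair_neg_one_iff.1 hu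
      · exact .inr ⟨n, .inl rfl⟩
      · exact .inr ⟨n, .inr (Units.val_neg _)⟩
  · rintro (rfl | ⟨n, rfl | rfl⟩)
    · exact .zero
    · exact unitOrZero_tau_zpow n
    · exact unitOrZero_neg_tau_zpow n

/-- The embedding of `ℤ[τ]` in the real numbers that sends `τ` to the golden ratio. -/
noncomputable def toReal : GoldenInteger →+* ℝ :=
  toRing Real.goldenRatio (by linear_combination Real.goldenRatio_sq)

theorem toReal_injective : Function.Injective toReal := by
  rw [injective_iff_map_eq_zero]
  rintro ⟨a, b⟩ h
  rw [toReal, toRing_apply] at h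
  have hb : b = 0 := by
    by_contra hb
    refine Real.goldenRatio_irrational ⟨-a / b, ?_⟩
    push_cast
    rw [div_eq_iff (Int.cast_ne_zero.2 hb)]
    linear_combination -h
  have ha : a = 0 := by simpa [hb] using h
  rw [ha, hb]
  rfl

theorem toReal_tau_zpow (n : ℤ) :
    toReal ↑(tau ^ n) = Real.goldenRatio ^ n := by
  have h := congrArg Units.val (map_zpow (Units.map (toReal : GoldenInteger →* ℝ)) tau n)
  rw [Units.val_zpow_eq_zpow_val] at h
  exact h.trans (congrArg (· ^ n) (toRing_tau _ (by linear_combination Real.goldenRatio_sq)))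

theorem goldenRatio_zpow_neg_two : Real.goldenRatio ^ (-2 : ℤ) = 2 - Real.goldenRatio := by
  rw [_root_.zpow_neg]
  refine inv_eq_of_mul_eq_one_right ?_
  rw [zpow_ofNat]
  linear_combination (1 - Real.goldenRatio) * Real.goldenRatio_sq

/- As `τ⁻¹ + τ⁻² = 1` and `2 τ⁻² < 1`, one of the two exponents is `-1`. -/
theorem eq_of_goldenRatio_zpow_add_zpow {k l : ℤ}
    (h : Real.goldenRatio ^ k + Real.goldenRatio ^ l = 1) :
    (k = -1 ∧ l = -2) ∨ (k = -2 ∧ l = -1) := by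
  have hτ := Real.one_lt_goldenRatio
  have hpos (n : ℤ) : 0 < Real.goldenRatio ^ n := zpow_pos Real.goldenRatio_pos n
  have hneg {n : ℤ} (hn : Real.goldenRatio ^ n < 1) : n ≤ -1 :=
    Int.le_sub_one_of_lt ((zpow_lt_one_iff_right₀ hτ).1 hn)
  have hrest {n : ℤ} (hn : Real.goldenRatio ^ (-1 : ℤ) + Real.goldenRatio ^ n = 1) : n = -2 := by
    apply (zpow_right_strictMono₀ hτ).injective
    rw [_root_.zpow_neg_one, Real.inv_goldenRatio] at hn
    simp only [goldenRatio_zpow_neg_two]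
    linarith [Real.goldenRatio_add_goldenConj]
  obtain rfl | hk := (hneg (show Real.goldenRatio ^ k < 1 by linarith [hpos l])).eq_or_lt
  · exact .inl ⟨rfl, hrest h⟩
  obtain rfl | hl := (hneg (show Real.goldenRatio ^ l < 1 by linarith [hpos k])).eq_or_lt
  · exact .inr ⟨hrest (by rw [add_comm, h]), rfl⟩
  have hk' := zpow_le_zpow_right₀ hτ.le (Int.le_sub_one_of_lt hk)
  have hl' := zpow_le_zpow_right₀ hτ.le (Int.le_sub_one_of_lt hl)
  norm_num only [goldenRatio_zpow_neg_two] at hk' hl'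
  nlinarith [Real.goldenRatio_sq]

theorem eq_of_one_add_tau_zpow {k l : ℤ}
    (h : (1 + ↑(tau ^ l) : GoldenInteger) = ↑(tau ^ k)) :
    (k = 1 ∧ l = -1) ∨ (k = 2 ∧ l = 1) := by
  have hreal := congrArg toReal h
  rw [map_add, map_one, toReal_tau_zpow, toReal_tau_zpow] at hreal
  have hdiv : Real.goldenRatio ^ (-k) + Real.goldenRatio ^ (l - k) = 1 := by
    rw [sub_eq_neg_add, zpow_add₀ Real.goldenRatio_ne_zero, ← mul_one_add, hreal,
      ← zpow_add₀ Real.goldenRatio_ne_zero, neg_add_cancel, zpow_zero]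
  have := eq_of_goldenRatio_zpow_add_zpow hdiv
  omega

theorem eq_of_tau_zpow_add_tau_zpow {k l : ℤ}
    (h : (↑(tau ^ k) + ↑(tau ^ l) : GoldenInteger) = 1) :
    (k = -1 ∧ l = -2) ∨ (k = -2 ∧ l = -1) :=
  eq_of_goldenRatio_zpow_add_zpow (by
    rw [← toReal_tau_zpow, ← toReal_tau_zpow, ← map_add, h, map_one])

/-- The fundamental elements `1, τ, -τ, τ⁻¹, -τ⁻¹, τ ^ 2, τ ^ -2` of the golden ratio partial
field. They form a list in order that relations between them can be decided. -/
def fundamentals : List GoldenInteger :=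
  [⟨1, 0⟩, ⟨0, 1⟩, ⟨0, -1⟩, ⟨-1, 1⟩, ⟨1, -1⟩, ⟨1, 1⟩, ⟨2, -1⟩]

theorem unitOrZero_of_mem_fundamentals {f : GoldenInteger} (hf : f ∈ fundamentals) :
    UnitOrZero units f := by
  simp only [fundamentals, List.mem_cons, List.not_mem_nil, or_false] at hf
  obtain rfl | rfl | rfl | rfl | rfl | rfl | rfl := hf
  exacts [unitOrZero_tau_zpow 0, unitOrZero_tau_zpow 1, unitOrZero_neg_tau_zpow 1,
    unitOrZero_tau_zpow (-1), unitOrZero_neg_tau_zpow (-1), unitOrZero_tau_zpow 2,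
    unitOrZero_tau_zpow (-2)]

theorem mem_fundamentals_of_isFundamental {f : GoldenInteger} (hf : IsFundamental units f) :
    f ∈ fundamentals := by
  obtain h0 | ⟨k, hk⟩ := unitOrZero_units_iff.1 hf.unitOrZero
  · exact absurd h0 hf.ne_zero
  obtain h1 | ⟨l, hl⟩ := unitOrZero_units_iff.1 hf.one_sub
  · rw [← sub_eq_zero.1 h1]
    decide
  have hpos (n : ℤ) : 0 < toReal ↑(tau ^ n) :=
    (toReal_tau_zpow n).symm ▸ zpow_pos Real.goldenRatio_pos n
  obtain rfl | rfl := hk <;> obtain hl | hl := hl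
  · obtain ⟨rfl, -⟩ | ⟨rfl, -⟩ := eq_of_tau_zpow_add_tau_zpow (k := k) (l := l)
      (by linear_combination -hl)
    all_goals decide
  · obtain ⟨rfl, -⟩ | ⟨rfl, -⟩ := eq_of_one_add_tau_zpow (k := k) (l := l)
      (by linear_combination hl)
    all_goals decide
  · obtain ⟨-, rfl⟩ | ⟨-, rfl⟩ := eq_of_one_add_tau_zpow (k := l) (l := k)
      (by linear_combination hl)
    all_goals decide
  · have hsum := congrArg toReal hl
    simp only [map_sub, map_neg, map_one] at hsum
    linarith [hpos k, hpos l]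

theorem isFundamental_iff_mem_fundamentals {f : GoldenInteger} :
    IsFundamental units f ↔ f ∈ fundamentals := by
  refine ⟨mem_fundamentals_of_isFundamental, fun hf => ?_⟩
  have hsub : ∀ f ∈ fundamentals, f ≠ 0 ∧ (1 - f = 0 ∨ 1 - f ∈ fundamentals) := by decide
  exact ⟨unitOrZero_of_mem_fundamentals hf, (hsub f hf).1,
    (hsub f hf).2.elim Or.inl unitOrZero_of_mem_fundamentals⟩

end GoldenInteger

end GoldenInteger

section Roots

theorem exists_mul_self_eq_one_add_of_isSquare_five {F : Type*} [Field F] (h2 : (2 : F) ≠ 0)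
    (h5 : IsSquare (5 : F)) : ∃ x : F, x * x = 1 + x := by
  obtain ⟨s, hs⟩ := h5
  refine ⟨(1 + s) / 2, ?_⟩
  field_simp
  linear_combination -hs

theorem isSquare_five_of_modEq {p : ℕ} [Fact p.Prime] (hp2 : p ≠ 2)
    (hp : (p : ℤ) ≡ 1 [ZMOD 5] ∨ (p : ℤ) ≡ -1 [ZMOD 5]) : IsSquare (5 : ZMod p) := by
  have hreciprocity := ZMod.exists_sq_eq_prime_iff_of_mod_four_eq_one (p := 5) (by norm_num) hp2
  have hp5 : (p : ZMod 5) = 1 ∨ (p : ZMod 5) = -1 := by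
    refine hp.imp (fun h => ?_) fun h => ?_
    all_goals simpa using (ZMod.intCast_eq_intCast_iff _ _ 5).2 h
  refine hreciprocity.1 ?_
  obtain h | h := hp5 <;> rw [h]
  · exact ⟨1, rfl⟩
  · exact ⟨2, rfl⟩

theorem exists_mul_self_eq_one_add_zmod {p : ℕ} [Fact p.Prime]
    (hp : (p : ℤ) ≡ 1 [ZMOD 5] ∨ (p : ℤ) ≡ -1 [ZMOD 5]) : ∃ x : ZMod p, x * x = 1 + x := by
  have hp2 : p ≠ 2 := by
    rintro rfl
    revert hp
    decide
  exact exists_mul_self_eq_one_add_of_isSquare_five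
    (Ring.two_ne_zero (by rwa [ZMod.ringChar_zmod_n])) (isSquare_five_of_modEq hp2 hp)

/- If `x ^ 2 = 1 + x` has no root in `ZMod p`, then adjoining one gives a field of order `p ^ 2`. -/
theorem exists_mul_self_eq_one_add_galoisField (p : ℕ) [Fact p.Prime] :
    ∃ x : GaloisField p 2, x * x = 1 + x := by
  by_cases h : ∃ r : ZMod p, r * r = 1 + r
  · obtain ⟨r, hr⟩ := h
    exact ⟨algebraMap _ _ r, by rw [← map_mul, hr, map_add, map_one]⟩
  · have : Fact (∀ r : ZMod p, r ^ 2 ≠ 1 + 1 * r) :=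
      ⟨fun r hr => h ⟨r, by linear_combination hr⟩⟩
    let e : QuadraticAlgebra (ZMod p) 1 1 ≃ₐ[ZMod p] GaloisField p 2 :=
      GaloisField.algEquivGaloisField p 2 (by
        rw [Nat.card_congr (QuadraticAlgebra.equivProd 1 1), Nat.card_prod, Nat.card_zmod, sq])
    refine ⟨e ⟨0, 1⟩, ?_⟩
    rw [← map_mul, ← map_one e, ← map_add]
    congr 1
    ext
    · simp [QuadraticAlgebra.re_one]
    · simp [QuadraticAlgebra.im_one]

end Roots

section Embeddings

theorem isEmbedding_id (F : Type*) [Field F] : IsEmbedding (MonoidHom.id F) ⊤ where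
  neg_one_mem := trivial
  unitOrZero_iff {x} := by
    refine iff_of_true ?_ ⟨x, rfl⟩
    obtain rfl | hx := eq_or_ne x 0
    · exact .zero
    · exact .of_mem (u := Units.mk0 x hx) trivial
  mem_padd_iff := Part.mem_some_iff

theorem unitOrZero_top_prod_iff {F G : Type*} [Field F] [Field G] {x : F × G} :
    UnitOrZero ⊤ x ↔ (x.1 ≠ 0 ↔ x.2 ≠ 0) := by
  constructor
  · rintro (rfl | ⟨u, -, rfl⟩)
    · simp
    · exact iff_of_true (u.isUnit.map (RingHom.fst F G)).ne_zero
        (u.isUnit.map (RingHom.snd F G)).ne_zero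
  · intro h
    by_cases h1 : x.1 = 0
    · exact .inl (Prod.ext h1 (by simpa [h1] using h))
    · exact .inr ⟨MulEquiv.prodUnits.symm (Units.mk0 _ h1, Units.mk0 _ (h.1 h1)), trivial, rfl⟩

/-- The inclusion of the partial field `F ⊗ G` in the ring `F × G`. -/
def Product.toProd (F G : Type*) [Field F] [Field G] : Product F G →* F × G where
  toFun p := p.1
  map_one' := rfl
  map_mul' _ _ := rfl

theorem isEmbedding_toProd (F G : Type*) [Field F] [Field G] :
    IsEmbedding (Product.toProd F G) ⊤ where
  neg_one_mem := trivial
  unitOrZero_iff {x} := unitOrZero_top_prod_iff.trans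
    ⟨fun h => ⟨⟨x, h⟩, rfl⟩, fun ⟨p, hp⟩ => hp ▸ p.2⟩
  mem_padd_iff {_ _ _} := by
    rw [Prod.ext_iff]
    exact Product.mem_padd.trans (Part.mem_some_iff.and Part.mem_some_iff)

namespace GoldenInteger

theorem mem_carrier_goldenRatio_iff {x : ℝ} :
    x ∈ carrier {Units.mk0 Real.goldenRatio Real.goldenRatio_ne_zero} ↔
      ∃ z, UnitOrZero units z ∧ toReal z = x := by
  rw [carrier, Set.singleton_union]
  constructor
  · rintro (rfl | ⟨u, hu, rfl⟩)
    · exact ⟨0, .zero, map_zero _⟩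
    · obtain ⟨n, rfl | rfl⟩ := mem_closure_pair_neg_one_iff.1 hu
      · exact ⟨_, unitOrZero_tau_zpow n, by simp [toReal_tau_zpow]⟩
      · exact ⟨_, unitOrZero_neg_tau_zpow n, by simp [toReal_tau_zpow]⟩
  · rintro ⟨z, hz, rfl⟩
    obtain rfl | ⟨n, rfl | rfl⟩ := unitOrZero_units_iff.1 hz
    · exact .inl (map_zero _)
    · exact .inr ⟨_, mem_closure_pair_neg_one_iff.2 ⟨n, .inl rfl⟩, by simp [toReal_tau_zpow]⟩
    · exact .inr ⟨_, mem_closure_pair_neg_one_iff.2 ⟨n, .inr rfl⟩, by simp [toReal_tau_zpow]⟩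

theorem exists_toReal_eq (p : GoldenRatioPartialField) :
    ∃ z, UnitOrZero units z ∧ toReal z = p.1 :=
  mem_carrier_goldenRatio_iff.1 p.2

/-- The inclusion of the golden ratio partial field in `ℤ[τ]`. -/
noncomputable def ofPartialField : GoldenRatioPartialField →* GoldenInteger where
  toFun p := (exists_toReal_eq p).choose
  map_one' := toReal_injective ((exists_toReal_eq 1).choose_spec.2.trans (map_one toReal).symm)
  map_mul' p q := toReal_injective (by
    rw [map_mul, (exists_toReal_eq p).choose_spec.2, (exists_toReal_eq q).choose_spec.2]
    exact (exists_toReal_eq (p * q)).choose_spec.2)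

theorem toReal_ofPartialField (p : GoldenRatioPartialField) : toReal (ofPartialField p) = p.1 :=
  (exists_toReal_eq p).choose_spec.2

theorem isEmbedding_ofPartialField : IsEmbedding ofPartialField units where
  neg_one_mem := neg_one_mem_units
  unitOrZero_iff {x} := by
    constructor
    · intro hx
      exact ⟨⟨toReal x, mem_carrier_goldenRatio_iff.2 ⟨x, hx, rfl⟩⟩,
        toReal_injective (toReal_ofPartialField _)⟩
    · rintro ⟨p, rfl⟩
      exact (exists_toReal_eq p).choose_spec.1
  mem_padd_iff {p q r} := by
    rw [← toReal_injective.eq_iff, map_add, toReal_ofPartialField, toReal_ofPartialField,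
      toReal_ofPartialField]
    exact OfRing.mem_padd

end GoldenInteger

end Embeddings

section LiftingToGoldenInteger

variable {F : Type*} [Field F] {w : F} (hw : w * w = 1 + w)

include hw in
theorem eq_of_natCard_eq_four [CharP F 2] (hF : Nat.card F = 4) (x : F) :
    x = 0 ∨ x = 1 ∨ x = w ∨ x = 1 + w := by
  have h2 : (2 : F) = 0 := CharTwo.two_eq_zero
  have hx : x ^ 4 = x := by
    have : Finite F := Nat.finite_of_card_ne_zero (by rw [hF]; decide)
    have := Fintype.ofFinite F
    rw [← hF, Nat.card_eq_fintype_card, FiniteField.pow_card]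
  have hprod : x * ((x - 1) * ((x - w) * (x - (1 + w)))) = 0 := by
    linear_combination hx + (x ^ 2 - x) * hw + (x ^ 2 - x ^ 3 + w * (1 - x) * (x ^ 2 - x)) * h2
  simpa only [mul_eq_zero, sub_eq_zero] using hprod

/- The norm `a ^ 2 + a b - b ^ 2` of `a + b τ` vanishes modulo `2` only if `a` and `b` do. -/
include hw in
theorem two_dvd_of_add_mul_eq_zero [CharP F 2] {a b : ℤ} (h : (a + b * w : F) = 0) :
    2 ∣ a ∧ 2 ∣ b := by
  have hnorm : ((a * a + a * b - b * b : ℤ) : F) = 0 := by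
    push_cast
    linear_combination (a + b - b * w) * h + b ^ 2 * hw
  have hdvd := (CharP.intCast_eq_zero_iff F 2 _).1 hnorm
  simp only [Nat.cast_ofNat, ← even_iff_two_dvd, Int.even_sub, Int.even_add, Int.even_mul]
    at hdvd ⊢
  tauto

namespace GoldenInteger

/-- The homomorphism `ℤ[τ] → GF(4) × GF(5)` that sends `τ` to `(w, 3)`. -/
def toProd : GoldenInteger →+* F × ZMod 5 :=
  toRing (w, 3) (Prod.ext hw (show (3 * 3 : ZMod 5) = 1 + 3 by decide))

theorem toProd_fst (z : GoldenInteger) : (toProd hw z).1 = z.re + z.im * w := by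
  rw [toProd, toRing_apply]
  rfl

theorem toProd_snd (z : GoldenInteger) : (toProd hw z).2 = z.re + z.im * 3 := by
  rw [toProd, toRing_apply]
  rfl

/-- A decidable form of the condition that `z` is in the kernel of `toProd`. -/
abbrev ReducesToZero (z : GoldenInteger) : Prop := (2 ∣ z.re ∧ 2 ∣ z.im) ∧ 5 ∣ z.re + z.im * 3

theorem reducesToZero_of_toProd_eq_zero [CharP F 2] {z : GoldenInteger} (hz : toProd hw z = 0) :
    ReducesToZero z := by
  refine ⟨two_dvd_of_add_mul_eq_zero hw ?_, (ZMod.intCast_zmod_eq_zero_iff_dvd _ 5).1 ?_⟩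
  · rw [← toProd_fst hw, hz, Prod.fst_zero]
  · push_cast
    rw [← toProd_snd hw, hz, Prod.snd_zero]

/- The exponent of `τ` is found by the Chinese remainder theorem: `w` has order `3`, and `3` has
order `4` modulo `5`. -/
theorem exists_units_toProd_eq [CharP F 2] (hF : Nat.card F = 4) (u : (F × ZMod 5)ˣ) :
    ∃ v ∈ units, toProd hw (v : GoldenInteger) = u := by
  have h1 : u.val.1 ≠ 0 := (u.isUnit.map (RingHom.fst _ _)).ne_zero
  have h2 : u.val.2 ≠ 0 := (u.isUnit.map (RingHom.snd _ _)).ne_zero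
  have hw3 : w ^ 3 = 1 := by linear_combination (w + 1) * hw + w * CharTwo.two_eq_zero (R := F)
  obtain ⟨i, hi⟩ : ∃ i : ℕ, w ^ i = u.val.1 := by
    obtain h | h | h | h := eq_of_natCard_eq_four hw hF u.val.1
    · exact absurd h h1
    · exact ⟨0, by rw [h, pow_zero]⟩
    · exact ⟨1, by rw [h, pow_one]⟩
    · exact ⟨2, by rw [h, sq, hw]⟩
  obtain ⟨j, hj⟩ : ∃ j : ℕ, (3 : ZMod 5) ^ j = u.val.2 := by
    have hpow : ∀ b : ZMod 5, b ≠ 0 → ∃ j : Fin 4, 3 ^ (j : ℕ) = b := by decide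
    obtain ⟨j, hj⟩ := hpow _ h2
    exact ⟨j, hj⟩
  refine ⟨tau ^ (4 * i + 9 * j), pow_mem (Subgroup.subset_closure (.inl rfl)) _, ?_⟩
  rw [Units.val_pow_eq_pow_val, map_pow, toProd, toRing_tau]
  refine Prod.ext ?_ ?_
  · calc w ^ (4 * i + 9 * j) = w ^ (3 * (i + 3 * j) + i) := by ring_nf
      _ = u.val.1 := by rw [pow_add, pow_mul, hw3, one_pow, one_mul, hi]
  · calc (3 : ZMod 5) ^ (4 * i + 9 * j) = 3 ^ (4 * (i + 2 * j) + j) := by ring_nf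
      _ = u.val.2 := by
        rw [pow_add, pow_mul, show (3 : ZMod 5) ^ 4 = 1 by decide, one_pow, one_mul, hj]

theorem exists_mem_fundamentals_toProd_eq [CharP F 2] (hF : Nat.card F = 4) {f : F × ZMod 5}
    (hf : IsFundamental ⊤ f) : ∃ g ∈ fundamentals, toProd hw g = f := by
  have h2 : (2 : F) = 0 := CharTwo.two_eq_zero
  obtain ⟨a, b⟩ := f
  obtain hf1 | hf1 := eq_or_ne (1 - (a, b)) 0
  · exact ⟨1, by decide, by rw [map_one, sub_eq_zero.1 hf1]⟩
  have hunit := hf.unitOrZero.isUnit hf.ne_zero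
  have hunit' := hf.one_sub.isUnit hf1
  have ha : a ≠ 0 := (hunit.map (RingHom.fst _ _)).ne_zero
  have hb : b ≠ 0 := (hunit.map (RingHom.snd _ _)).ne_zero
  have ha1 : 1 - a ≠ 0 := (hunit'.map (RingHom.fst _ _)).ne_zero
  have hb1 : 1 - b ≠ 0 := (hunit'.map (RingHom.snd _ _)).ne_zero
  have haw : a = w ∨ a = 1 + w := by
    simpa [ha, (sub_ne_zero.1 ha1).symm] using eq_of_natCard_eq_four hw hF a
  have hb234 : ∀ b : ZMod 5, b ≠ 0 → 1 - b ≠ 0 → b = 2 ∨ b = 3 ∨ b = 4 := by decide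
  have hlift (g) (hg : g ∈ fundamentals) (h1 : (g.re + g.im * w : F) = a)
      (h2 : (g.re + g.im * 3 : ZMod 5) = b) : ∃ g ∈ fundamentals, toProd hw g = (a, b) :=
    ⟨g, hg, Prod.ext ((toProd_fst hw g).trans h1) ((toProd_snd hw g).trans h2)⟩
  obtain rfl | rfl := haw <;> obtain rfl | rfl | rfl := hb234 b hb hb1
  · exact hlift ⟨0, -1⟩ (by decide) (by push_cast; linear_combination -a * h2) (by decide)
  · exact hlift ⟨0, 1⟩ (by decide) (by push_cast; ring) (by decide)
  · exact hlift ⟨2, -1⟩ (by decide) (by push_cast; linear_combination (1 - a) * h2) (by decide)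
  · exact hlift ⟨-1, 1⟩ (by decide) (by push_cast; linear_combination -h2) (by decide)
  · exact hlift ⟨1, -1⟩ (by decide) (by push_cast; linear_combination -w * h2) (by decide)
  · exact hlift ⟨1, 1⟩ (by decide) (by push_cast; ring) (by decide)

theorem mul_mul_eq_one_of_reducesToZero : ∀ f ∈ fundamentals, ∀ g ∈ fundamentals,
    ∀ h ∈ fundamentals, ReducesToZero (f * g * h - 1) → f * g * h = 1 := by
  decide +kernel

theorem eq_neg_of_reducesToZero : ∀ f ∈ fundamentals, ∀ g ∈ fundamentals,
    ReducesToZero (f + g) → f = -g := by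
  decide

theorem isLifting_toProd [CharP F 2] (hF : Nat.card F = 4) : IsLifting (toProd hw) units ⊤ where
  neg_one_mem_source := neg_one_mem_units
  neg_one_mem_target := trivial
  surj u _ := exists_units_toProd_eq hw hF u
  exists_fundamental f hf := by
    obtain ⟨g, hg, h⟩ := exists_mem_fundamentals_toProd_eq hw hF hf
    exact ⟨g, isFundamental_iff_mem_fundamentals.2 hg, h⟩
  eq_one f g h hf hg hh e := by
    simp only [isFundamental_iff_mem_fundamentals] at hf hg hh
    refine mul_mul_eq_one_of_reducesToZero f hf g hg h hh (reducesToZero_of_toProd_eq_zero hw ?_)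
    rw [map_sub, e, map_one, sub_self]
  eq_neg f g hf hg e := by
    simp only [isFundamental_iff_mem_fundamentals] at hf hg
    refine eq_neg_of_reducesToZero f hf g hg (reducesToZero_of_toProd_eq_zero hw ?_)
    rw [map_add, e, neg_add_cancel]

end GoldenInteger

end LiftingToGoldenInteger

section Matroid

variable {α : Type*} {M : Matroid α}

theorem IsRepresentedBy.isRepresentableOver {F : Type*} [Field F] {r : ℕ}
    {D : Matrix (Fin r) M.E F} (hM : IsRepresentedBy M D) : M.IsRepresentableOver F :=
  (isEmbedding_id F).isRepresentableOver (fun _ _ _ => (isEmbedding_id F).unitOrZero _) hM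

theorem isRepresentableOver_of_preservesSums {P : Type*} [PartialField P] {F : Type*} [Field F]
    {f : P →* F} (hf : PreservesSums f) (h : M.IsRepresentableOver P) :
    M.IsRepresentableOver F := by
  obtain ⟨r, A, -, hM⟩ := hf.exists_isRepresentedBy h
  exact hM.isRepresentableOver

theorem isRepresentableOver_of_golden (h : M.IsRepresentableOver GoldenRatioPartialField)
    {F : Type*} [Field F] (hF : ∃ x : F, x * x = 1 + x) : M.IsRepresentableOver F := by
  obtain ⟨x, hx⟩ := hF
  refine isRepresentableOver_of_preservesSums (f := (GoldenInteger.toRing x hx :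
    GoldenInteger →* F).comp GoldenInteger.ofPartialField) (fun p q r hr => ?_) h
  have hadd := GoldenInteger.isEmbedding_ofPartialField.preservesSums hr
  exact (congrArg (GoldenInteger.toRing x hx) hadd).trans (map_add _ _ _)

theorem isRepresentableOver_of_isLifting {P Q : Type*} [PartialField P] [PartialField Q]
    {R S : Type*} [CommRing R] [CommRing S] [Nontrivial R] [Nontrivial S] {K : Subgroup Sˣ}
    {H : Subgroup Rˣ} {φ : S →+* R} (L : IsLifting φ K H) {f : P →* R} (hf : IsEmbedding f H)
    {g : Q →* S} (hg : IsEmbedding g K) [M.Finite] (h : M.IsRepresentableOver P) :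
    M.IsRepresentableOver Q := by
  obtain ⟨r, A, -, hA⟩ := hf.preservesSums.exists_isRepresentedBy h
  obtain ⟨g₀, hg₀⟩ := hA.exists_isBase
  obtain ⟨D, -, hM, hD⟩ := hf.exists_standard h hg₀
  have : Finite M.E := M.ground_finite
  obtain ⟨E, hE, rfl⟩ := hD.hasStrongLift L
  refine hg.isRepresentableOver hE ⟨hM.exists_range_eq, fun g => ?_⟩
  rw [hM.isBase_iff, submatrix_map, ← RingHom.mapMatrix_apply, ← RingHom.map_det]
  exact (hE r id g).map_eq_zero.not

theorem isRepresentableOver_product {F G : Type*} [Field F] [Field G]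
    (hF : M.IsRepresentableOver F) (hG : M.IsRepresentableOver G) :
    M.IsRepresentableOver (Product F G) := by
  obtain ⟨r, A₀, -, hA₀⟩ := (isEmbedding_id F).preservesSums.exists_isRepresentedBy hF
  obtain ⟨g₀, hg₀⟩ := hA₀.exists_isBase
  obtain ⟨A, hA1, hA, -⟩ := (isEmbedding_id F).exists_standard hF hg₀
  obtain ⟨B, hB1, hB, -⟩ := (isEmbedding_id G).exists_standard hG hg₀
  let D : Matrix (Fin r) M.E (F × G) := of fun i j => (A i j, B i j)
  have hD1 : D.submatrix id g₀ = 1 := by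
    ext i j
    · exact (congrFun₂ hA1 i j).trans (by simp only [one_apply]; split <;> rfl)
    · exact (congrFun₂ hB1 i j).trans (by simp only [one_apply]; split <;> rfl)
  have hfst (g : Fin r → M.E) : (D.submatrix id g).det.1 = (A.submatrix id g).det :=
    RingHom.map_det (RingHom.fst F G) _
  have hsnd (g : Fin r → M.E) : (D.submatrix id g).det.2 = (B.submatrix id g).det :=
    RingHom.map_det (RingHom.snd F G) _
  have hdet (g : Fin r ↪ M.E) : (A.submatrix id g).det ≠ 0 ↔ (B.submatrix id g).det ≠ 0 :=
    (hA.isBase_iff g).symm.trans (hB.isBase_iff g)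
  have hD (g : Fin r → M.E) : UnitOrZero ⊤ (D.submatrix id g).det :=
    unitOrZero_det_of_injective _ id g fun _ hg => unitOrZero_top_prod_iff.2 (by
      rw [hfst, hsnd]
      exact hdet ⟨g, hg⟩)
  refine (isEmbedding_toProd F G).isRepresentableOver
    (isStrong_of_submatrix_eq_one hD1 hD) ⟨hA.exists_range_eq, fun g => ?_⟩
  rw [hA.isBase_iff, Ne, Ne, Prod.ext_iff, hfst, hsnd, not_iff_not]
  exact ⟨fun h => ⟨h, not_not.1 (mt (hdet g).2 (not_not.2 h))⟩, fun h => h.1⟩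

theorem isRepresentableOver_golden_of_product [M.Finite]
    (h : M.IsRepresentableOver (Product (GaloisField 2 2) (ZMod 5))) :
    M.IsRepresentableOver GoldenRatioPartialField := by
  obtain ⟨w, hw⟩ := exists_mul_self_eq_one_add_galoisField 2
  have hcard : Nat.card (GaloisField 2 2) = 4 := GaloisField.card 2 2 two_ne_zero
  exact isRepresentableOver_of_isLifting (GoldenInteger.isLifting_toProd hw hcard)
    (isEmbedding_toProd _ _) GoldenInteger.isEmbedding_ofPartialField h

end Matroid

end PartialField

theorem mainTheorem3 {α : Type*} (M : Matroid α) [M.Finite] :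
    List.TFAE
      [M.IsRepresentableOver (PartialField.Product (GaloisField 2 2) (ZMod 5)),
       M.IsRepresentableOver GoldenRatioPartialField,
       M.IsRepresentableOver (ZMod 5) ∧
         (∀ (p : ℕ) [Fact p.Prime], M.IsRepresentableOver (GaloisField p 2)) ∧
         (∀ (p : ℕ) [Fact p.Prime], ((p : ℤ) ≡ 1 [ZMOD 5] ∨ (p : ℤ) ≡ -1 [ZMOD 5]) →
           M.IsRepresentableOver (ZMod p))] := by
  tfae_have 1 → 2 := PartialField.isRepresentableOver_golden_of_product
  tfae_have 2 → 3 := fun h =>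
    ⟨PartialField.isRepresentableOver_of_golden h ⟨3, by decide⟩,
      fun p _ => PartialField.isRepresentableOver_of_golden h
        (PartialField.exists_mul_self_eq_one_add_galoisField p),
      fun p _ hp => PartialField.isRepresentableOver_of_golden h
        (PartialField.exists_mul_self_eq_one_add_zmod hp)⟩
  tfae_have 3 → 1 := fun h => PartialField.isRepresentableOver_product (h.2.1 2) h.1
  tfae_finish
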